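/- Conventions. All manifolds are smooth, Hausdorff, second countable and without boundary. A natural polydifferential operator $D$ of rank $r=\ell+1\ge 1$ on $n$-manifolds assigns to each Riemannian $n$-manifold $(M,g)$ a linear operator $D^g\colon C^\infty(M)^{\otimes(r-1)}\to C^\infty(M)$ such that $D^g(u_1\otimes\dots\otimes u_{r-1})$ is a universal (coefficients independent of $(M,g)$) linear combination of complete contractions of tensor products of covariant derivatives of the Riemann curvature tensor and covariant derivatives of $u_1,\dots,u_{r-1}$. Its Dirichlet form is $\mathfrak D^g(u_1\otimes\dots\otimes u_r)=\int_M u_1D^g(u_2\otimes\dots\otimes u_r)\,\mathrm{dvol}_g$. A constrained polydifferential operator $(D,\mathscr C)$ of rank $r$ and homogeneity $-2k$ ($k\in\{0,1,2,\dots\}$) consists of (a) a natural polydifferential operator $D$ of rank $r$ with $D^{c^2g}=c^{-2k}D^g$ for all constants $c>0$, whose Dirichlet form is symmetric on compactly supported functions and satisfies, for some $w\in\mathbb R$, $\mathfrak D^{e^{2\Upsilon}g}(e^{w\Upsilon}u_1\otimes\dots\otimes e^{w\Upsilon}u_r)=\mathfrak D^g(u_1\otimes\dots\otimes u_r)$ for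 all $g$, all $\Upsilon\in C^\infty(M)$ and all compactly supported $u_i$; and (b) a (possibly empty) finite set $\mathscr C$ of symmetric, conformally covariant natural polydifferential operators such that each $C\in\mathscr C$, of rank $r(C)$, satisfies $C^{e^{2\Upsilon}g}(u^{\otimes(r(C)-1)})=e^{b(C)\Upsilon}C^g\bigl((e^{\frac{n-2k}{r}\Upsilon}u)^{\otimes(r(C)-1)}\bigr)$ for some $b(C)\in\mathbb R$ and all $(M,g)$, $\Upsilon$, $u$. Here an operator $C$ of rank $\ell+1$ is conformally covariant if there are weights $a_1,\dots,a_\ell,b\in\mathbb R$ with $C^{e^{2\Upsilon}g}(u_1\otimes\dots\otimes u_\ell)=e^{b\Upsilon}C^g(e^{-a_1\Upsilon}u_1\otimes\dots\otimes e^{-a_\ell\Upsilon}u_\ell)$. Let $-2k>-n$ and $r^*:=rn/(n-2k)$. Put $U^g_{\mathscr C}:=\{u\in C^\infty(M): C^g(u^{\otimes(r(C)-1)})>0 \text{ on } M \text{ for all } C\in\mathscr C\}$, and for a compact conformal $n$-manifold $(M,\mathfrak c)$ and $g\in\mathfrak c$ put $$Y_{(D,\mathscr C)}(M,\mathfrak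 c):=\inf\{\mathfrak D^g(u^{\otimes r}) : u\in U^g_{\mathscr C},\ \|u\|_{L^{r^*}(M,g)}=1\}\in[-\infty,+\infty],$$ which does not depend on the choice of $g\in\mathfrak c$. Consider the equation $$D^g(u^{\otimes(r-1)})=|u|^{\frac{(r-2)n+4k}{n-2k}}u. \tag{$*$}$$ Smooth functions $u_1,u_2$ on $(M,g)$, $g\in\mathfrak c$, are geometrically distinct if there is no diffeomorphism $\Phi$ of $M$ with $\Phi^*g\in\mathfrak c$ and $u_1=|J_\Phi|^{\frac{n-2k}{rn}}\Phi^*u_2$, where $\mathrm{dvol}_{\Phi^*g}=|J_\Phi|\,\mathrm{dvol}_g$. A covering is regular if its deck transformations act transitively on its fibers. A covering $\pi\colon\widetilde M\to M$ of smooth manifolds is a local diffeomorphism, and $\pi^*\mathfrak c:=[\pi^*g]$ for $g\in\mathfrak c$. **Theorem.** Let $(D,\mathscr C)$ be a constrained polydifferential operator of rank $r$ and homogeneity $-2k>-n$ on $n$-manifolds. Let $\mathscr A$ be a set of compact connected conformal $n$-manifolds such that 1. if $(M,\mathfrak c)\in\mathscr A$, then $Y_{(D,\mathscr C)}(M,\mathfrak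 c)>0$; 2. there is a constant $\Lambda>0$ such that for all $(M,\mathfrak c)\in\mathscr A$ and all $g\in\mathfrak c$ there is a solution $u\in U^g_{\mathscr C}$, $u\not\equiv 0$, of $(*)$ with $\|u\|_{L^{r^*}(M,g)}\le\Lambda$; 3. if $(M,\mathfrak c)\in\mathscr A$ and $\pi\colon\widetilde M\to M$ is a finite connected covering, then $(\widetilde M,\pi^*\mathfrak c)\in\mathscr A$. Let $(M,\mathfrak c)\in\mathscr A$ be such that $\pi_1(M)$ has infinite profinite completion. Then for each $m\in\mathbb N$ there is a finite regular connected covering $\pi\colon\widetilde M\to M$ such that for every $g\in\mathfrak c$ there are at least $m$ pairwise geometrically distinct solutions $u\not\equiv 0$ of $(*)$, with $g$ replaced by $\pi^*g$, in $U^{\pi^*g}_{\mathscr C}$. -/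

import Mathlib

open scoped Manifold ContDiff Topology
open MeasureTheory Set

universe u

noncomputable section

namespace ConformalYamabe

/-! ### Manifolds, metrics, smooth functions -/

/-- The model space `ℝⁿ` with its Euclidean structure. -/
abbrev E (n : ℕ) : Type := EuclideanSpace ℝ (Fin n)

/-- A smooth `n`-manifold: Hausdorff, second countable, without boundary. It need be neither
compact nor connected. -/
structure SmoothManifold (n : ℕ) : Type (u + 1) where
  carrier : Type u
  [topology : TopologicalSpace carrier]
  [charted : ChartedSpace (E n) carrier]
  [smooth : IsManifold (𝓡 n) ∞ carrier]
  [hausdorff : T2Space carrier]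
  [secondCountable : SecondCountableTopology carrier]

instance (n : ℕ) : CoeSort (SmoothManifold.{u} n) (Type u) := ⟨SmoothManifold.carrier⟩

attribute [instance] SmoothManifold.topology SmoothManifold.charted SmoothManifold.smooth
  SmoothManifold.hausdorff SmoothManifold.secondCountable

instance {n : ℕ} (M : SmoothManifold.{u} n) : MeasurableSpace M := borel M

instance {n : ℕ} (M : SmoothManifold.{u} n) : BorelSpace M := ⟨rfl⟩

/-- Smooth Riemannian metrics on `M`. -/
abbrev Metric {n : ℕ} (M : SmoothManifold.{u} n) : Type u :=
  Bundle.ContMDiffRiemannianMetric (𝓡 n) ∞ (E n) (fun x : M => TangentSpace (𝓡 n) x)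

/-- The algebra `C^∞(M)`. -/
abbrev SmoothFun {n : ℕ} (M : SmoothManifold.{u} n) : Type u :=
  ContMDiffMap (𝓡 n) 𝓘(ℝ, ℝ) M ℝ ∞

/-- The smooth function `e^{tΥ} v`. -/
def expMul {n : ℕ} {M : SmoothManifold.{u} n} (t : ℝ) (Υ v : SmoothFun M) : SmoothFun M :=
  ⟨fun x => Real.exp (t * Υ x) * v x,
    (Real.contDiff_exp.contMDiff.comp (contMDiff_const.mul Υ.contMDiff)).mul v.contMDiff⟩

/-- `ĝ = e^{2Υ} g`. -/
def IsConformalChange {n : ℕ} {M : SmoothManifold.{u} n} (g ĝ : Metric M) (Υ : SmoothFun M) :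
    Prop :=
  ∀ (x : M) (v w : TangentSpace (𝓡 n) x),
    ĝ.inner x v w = Real.exp (2 * Υ x) * g.inner x v w

/-- `ĝ` and `g` are conformally related. -/
def IsConformal {n : ℕ} {M : SmoothManifold.{u} n} (g ĝ : Metric M) : Prop :=
  ∃ Υ : SmoothFun M, IsConformalChange g ĝ Υ

/-- `ĝ = c² g` for a constant `c`. -/
def IsScaling {n : ℕ} {M : SmoothManifold.{u} n} (c : ℝ) (g ĝ : Metric M) : Prop :=
  ∀ (x : M) (v w : TangentSpace (𝓡 n) x), ĝ.inner x v w = c ^ 2 * g.inner x v w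

/-- `h = π^* g` for a map `π : N → M`. -/
def IsPullback {n : ℕ} {M N : SmoothManifold.{u} n} (π : N → M) (g : Metric M) (h : Metric N) :
    Prop :=
  ∀ (x : N) (v w : TangentSpace (𝓡 n) x),
    h.inner x v w =
      g.inner (π x) (mfderiv (𝓡 n) (𝓡 n) π x v) (mfderiv (𝓡 n) (𝓡 n) π x w)

/-! ### Riemannian geometry in a chart -/

/-- Charts of `M` (in the maximal smooth atlas). -/
abbrev smoothCharts {n : ℕ} (M : SmoothManifold.{u} n) : Set (OpenPartialHomeomorph M (E n)) :=
  IsManifold.maximalAtlas (𝓡 n) ∞ M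

/-- The coordinate vector field `∂ᵢ` of the chart `φ`, at the point with coordinates `y`. -/
def coordVector {n : ℕ} {M : SmoothManifold.{u} n} (φ : OpenPartialHomeomorph M (E n)) (y : E n)
    (i : Fin n) : TangentSpace (𝓡 n) (φ.symm y) :=
  mfderiv 𝓘(ℝ, E n) (𝓡 n) φ.symm y (EuclideanSpace.single i (1 : ℝ) : E n)

/-- The matrix `g_{ij}` of the metric in the chart `φ`, as a function of the coordinates. -/
def metricMatrix {n : ℕ} {M : SmoothManifold.{u} n} (g : Metric M)
    (φ : OpenPartialHomeomorph M (E n)) (y : E n) : Matrix (Fin n) (Fin n) ℝ :=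
  Matrix.of fun i j => g.inner (φ.symm y) (coordVector φ y i) (coordVector φ y j)

/-- The partial derivative `∂ᵢ f` on `ℝⁿ`. -/
def pderiv {n : ℕ} (i : Fin n) (f : E n → ℝ) (y : E n) : ℝ :=
  fderiv ℝ f y (EuclideanSpace.single i (1 : ℝ))

/-- The Christoffel symbol `Γᵏᵢⱼ` of the Levi-Civita connection of `G = (g_{ij})`. -/
def christoffel {n : ℕ} (G : E n → Matrix (Fin n) (Fin n) ℝ) (k i j : Fin n) (y : E n) : ℝ :=
  (1 / 2) * ∑ l, (G y)⁻¹ k l *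
    (pderiv i (fun z => G z j l) y + pderiv j (fun z => G z i l) y - pderiv l (fun z => G z i j) y)

/-- Components of a covariant `p`-tensor field in coordinates. -/
abbrev CoordTensor (n p : ℕ) : Type := (Fin p → Fin n) → E n → ℝ

/-- The Riemann curvature tensor `R_{ijkl} = g(R(∂ᵢ, ∂ⱼ)∂ₖ, ∂ₗ)`, where
`R(X, Y) = ∇_X ∇_Y - ∇_Y ∇_X - ∇_{[X,Y]}`. -/
def riemann {n : ℕ} (G : E n → Matrix (Fin n) (Fin n) ℝ) : CoordTensor n 4 := fun I y =>
  ∑ m, G y m (I 3) *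
    (pderiv (I 0) (christoffel G m (I 1) (I 2)) y - pderiv (I 1) (christoffel G m (I 0) (I 2)) y
      + ∑ p, (christoffel G m (I 0) p y * christoffel G p (I 1) (I 2) y
        - christoffel G m (I 1) p y * christoffel G p (I 0) (I 2) y))

/-- The covariant derivative of a covariant tensor; the new index comes first:
`(∇T)_{i₀ i₁ … iₚ} = ∂_{i₀} T_{i₁ … iₚ} - ∑ₛ Γˡ_{i₀ iₛ} T_{i₁ … l … iₚ}`. -/
def covDeriv {n p : ℕ} (G : E n → Matrix (Fin n) (Fin n) ℝ) (T : CoordTensor n p) :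
    CoordTensor n (p + 1) := fun I y =>
  pderiv (I 0) (T (Fin.tail I)) y
    - ∑ s : Fin p, ∑ l : Fin n,
        christoffel G l (I 0) (Fin.tail I s) y * T (Function.update (Fin.tail I) s l) y

/-- The iterated covariant derivative `∇ᴺ T`. -/
def iterCovDeriv {n p : ℕ} (G : E n → Matrix (Fin n) (Fin n) ℝ) (T : CoordTensor n p) :
    (N : ℕ) → CoordTensor n (p + N)
  | 0 => T
  | N + 1 => covDeriv G (iterCovDeriv G T N)

/-- The scheme of a complete contraction of
`∇^{N₁} Rm ⊗ ⋯ ⊗ ∇^{Nₐ} Rm ⊗ ∇^{K₁} u₁ ⊗ ⋯ ⊗ ∇^{K_ℓ} u_ℓ`: the orders of differentiation, and a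
pairing of all index slots, along which one contracts with the inverse metric. -/
structure Contraction (ℓ : ℕ) where
  numCurv : ℕ
  curvOrder : Fin numCurv → ℕ
  funOrder : Fin ℓ → ℕ
  numPairs : ℕ
  pairing : ((Σ a : Fin numCurv, Fin (4 + curvOrder a)) ⊕ (Σ b : Fin ℓ, Fin (0 + funOrder b))) ≃
    Fin numPairs × Fin 2

/-- The index slots of a contraction scheme. -/
abbrev Contraction.Slot {ℓ : ℕ} (c : Contraction ℓ) : Type :=
  (Σ a : Fin c.numCurv, Fin (4 + c.curvOrder a)) ⊕ (Σ b : Fin ℓ, Fin (0 + c.funOrder b))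

/-- The value in coordinates of a complete contraction, for the metric `G = (g_{ij})` and
the functions `u₁, …, u_ℓ`. -/
def Contraction.eval {n ℓ : ℕ} (c : Contraction ℓ) (G : E n → Matrix (Fin n) (Fin n) ℝ)
    (f : Fin ℓ → E n → ℝ) (y : E n) : ℝ :=
  ∑ I : c.Slot → Fin n,
    (∏ a, (G y)⁻¹ (I (c.pairing.symm (a, 0))) (I (c.pairing.symm (a, 1)))) *
    (∏ a, iterCovDeriv G (riemann G) (c.curvOrder a) (fun s => I (Sum.inl ⟨a, s⟩)) y) *
    (∏ b, iterCovDeriv G (p := 0) (fun _ => f b) (c.funOrder b) (fun s => I (Sum.inr ⟨b, s⟩)) y)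

/-! ### Polydifferential operators -/

/-- A natural polydifferential operator of rank `ℓ + 1` on `n`-manifolds: to each Riemannian
`n`-manifold `(M, g)` it assigns a linear operator `C^∞(M)^{⊗ ℓ} → C^∞(M)`, given as a multilinear
map, which is expressed by one universal linear combination of complete contractions. (A complete
contraction is a scalar, so it may be computed in any chart.) -/
structure PolydiffOp (n ℓ : ℕ) : Type (u + 1) where
  toFun : ∀ (M : SmoothManifold.{u} n), Metric M →
    MultilinearMap ℝ (fun _ : Fin ℓ => SmoothFun M) (SmoothFun M)
  natural : ∃ L : List (ℝ × Contraction ℓ),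
    ∀ (M : SmoothManifold.{u} n) (g : Metric M) (v : Fin ℓ → SmoothFun M),
      ∀ φ ∈ smoothCharts M, ∀ x ∈ φ.source,
        toFun M g v x =
          (L.map fun t => t.1 *
            t.2.eval (metricMatrix g φ) (fun b y => v b (φ.symm y)) (φ x)).sum

/-- The Riemannian density `√(det g_{ij})` in the chart `φ`. -/
def chartDensity {n : ℕ} {M : SmoothManifold.{u} n} (g : Metric M)
    (φ : OpenPartialHomeomorph M (E n)) (y : E n) : ℝ :=
  Real.sqrt (metricMatrix g φ y).det

/-- The restriction of the Riemannian volume measure to the domain of the chart `φ`: the image of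
`√(det g_{ij}) dy` on the range of `φ`. -/
def chartVolume {n : ℕ} {M : SmoothManifold.{u} n} (g : Metric M)
    (φ : OpenPartialHomeomorph M (E n)) : Measure M :=
  ((volume.restrict φ.target).withDensity
    (fun y => ENNReal.ofReal (chartDensity g φ y))).map φ.symm

/-- The Riemannian volume measure `dvol_g`. The measures `chartVolume g φ` are the restrictions of
`dvol_g` to the chart domains; countably many chart domains cover `M`, so `dvol_g` is their
supremum, i.e. the least measure that dominates all of them. -/
def vol {n : ℕ} {M : SmoothManifold.{u} n} (g : Metric M) : Measure M :=
  ⨆ φ ∈ smoothCharts M, chartVolume g φ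

/-- The Dirichlet form `𝔇^g(u₁ ⊗ ⋯ ⊗ u_{ℓ+1}) = ∫_M u₁ D^g(u₂ ⊗ ⋯ ⊗ u_{ℓ+1}) dvol_g`. -/
def PolydiffOp.dirichlet {n ℓ : ℕ} (D : PolydiffOp.{u} n ℓ) {M : SmoothManifold.{u} n}
    (g : Metric M) (v : Fin (ℓ + 1) → SmoothFun M) : ℝ :=
  ∫ x, v 0 x * D.toFun M g (Fin.tail v) x ∂(vol g)

/-- Symmetry of an operator in its arguments. -/
def PolydiffOp.IsSymmetric {n ℓ : ℕ} (D : PolydiffOp.{u} n ℓ) : Prop :=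
  ∀ (M : SmoothManifold.{u} n) (g : Metric M) (v : Fin ℓ → SmoothFun M) (σ : Equiv.Perm (Fin ℓ)),
    D.toFun M g (v ∘ σ) = D.toFun M g v

/-- Conformal covariance with some weights `a₁, …, a_ℓ, b`:
`D^{ĝ}(u₁ ⊗ ⋯ ⊗ u_ℓ) = e^{bΥ} D^g(e^{-a₁Υ} u₁ ⊗ ⋯ ⊗ e^{-a_ℓΥ} u_ℓ)` if `ĝ = e^{2Υ} g`. -/
def PolydiffOp.IsConformallyCovariant {n ℓ : ℕ} (D : PolydiffOp.{u} n ℓ) : Prop :=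
  ∃ (a : Fin ℓ → ℝ) (b : ℝ), ∀ (M : SmoothManifold.{u} n) (g ĝ : Metric M) (Υ : SmoothFun M),
    IsConformalChange g ĝ Υ → ∀ v : Fin ℓ → SmoothFun M,
      D.toFun M ĝ v = expMul b Υ (D.toFun M g fun i => expMul (-a i) Υ (v i))

/-- Formal self-adjointness: the Dirichlet form is symmetric on compactly supported functions. -/
def PolydiffOp.IsFormallySelfAdjoint {n ℓ : ℕ} (D : PolydiffOp.{u} n ℓ) : Prop :=
  ∀ (M : SmoothManifold.{u} n) (g : Metric M) (v : Fin (ℓ + 1) → SmoothFun M),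
    (∀ i, HasCompactSupport (v i)) → ∀ σ : Equiv.Perm (Fin (ℓ + 1)),
      D.dirichlet g (v ∘ σ) = D.dirichlet g v

/-- Conformal invariance of the Dirichlet form with some weight `w`:
`𝔇^{ĝ}(e^{wΥ} u₁ ⊗ ⋯ ⊗ e^{wΥ} u_{ℓ+1}) = 𝔇^g(u₁ ⊗ ⋯ ⊗ u_{ℓ+1})` if `ĝ = e^{2Υ} g`. -/
def PolydiffOp.HasInvariantDirichletForm {n ℓ : ℕ} (D : PolydiffOp.{u} n ℓ) : Prop :=
  ∃ w : ℝ, ∀ (M : SmoothManifold.{u} n) (g ĝ : Metric M) (Υ : SmoothFun M),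
    IsConformalChange g ĝ Υ → ∀ v : Fin (ℓ + 1) → SmoothFun M,
      (∀ i, HasCompactSupport (v i)) →
        D.dirichlet ĝ (fun i => expMul w Υ (v i)) = D.dirichlet g v

/-- `D` has homogeneity `-2k`: `D^{c²g} = c^{-2k} D^g` for all constants `c > 0`. -/
def PolydiffOp.HasHomogeneity {n ℓ : ℕ} (D : PolydiffOp.{u} n ℓ) (k : ℕ) : Prop :=
  ∀ (M : SmoothManifold.{u} n) (g ĝ : Metric M) (c : ℝ), 0 < c → IsScaling c g ĝ →
    ∀ v : Fin ℓ → SmoothFun M, D.toFun M ĝ v = (c ^ (2 * k))⁻¹ • D.toFun M g v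

/-- A constrained polydifferential operator `(D, 𝒞)` of rank `r = ℓ + 1` and homogeneity `-2k`
on `n`-manifolds. The elements of `𝒞` may have different ranks. -/
structure ConstrainedOp (n ℓ k : ℕ) : Type (u + 1) where
  op : PolydiffOp.{u} n ℓ
  selfAdjoint : op.IsFormallySelfAdjoint
  covariant : op.HasInvariantDirichletForm
  homogeneity : op.HasHomogeneity k
  constraints : Set (Σ j : ℕ, PolydiffOp.{u} n j)
  finite_constraints : constraints.Finite
  constraint_symmetric : ∀ C ∈ constraints, C.2.IsSymmetric
  constraint_covariant : ∀ C ∈ constraints, C.2.IsConformallyCovariant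
  constraint_weight : ∀ C ∈ constraints, ∃ b : ℝ,
    ∀ (M : SmoothManifold.{u} n) (g ĝ : Metric M) (Υ : SmoothFun M), IsConformalChange g ĝ Υ →
      ∀ v : SmoothFun M, C.2.toFun M ĝ (fun _ => v) =
        expMul b Υ (C.2.toFun M g fun _ => expMul (((n : ℝ) - 2 * k) / (ℓ + 1)) Υ v)

namespace ConstrainedOp

variable {n ℓ k : ℕ} (D : ConstrainedOp.{u} n ℓ k) {M : SmoothManifold.{u} n}

/-- The constrained cone `U_𝒞^g`. -/
def cone (g : Metric M) : Set (SmoothFun M) :=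
  {v | ∀ C ∈ D.constraints, ∀ x, 0 < C.2.toFun M g (fun _ => v) x}

/-- The exponent `r^* = rn/(n-2k)`, where `r = ℓ + 1`. -/
def critExp (_D : ConstrainedOp.{u} n ℓ k) : ℝ := (ℓ + 1) * n / ((n : ℝ) - 2 * k)

/-- The norm `‖v‖_{r^*}` with respect to `dvol_g`. -/
def critNorm (g : Metric M) (v : SmoothFun M) : ℝ :=
  lpNorm (v : M → ℝ) (ENNReal.ofReal D.critExp) (vol g)

/-- `v` solves `D^g(v^{⊗(r-1)}) = |v|^{((r-2)n+4k)/(n-2k)} v`, where `r = ℓ + 1`. -/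
def SolvesPDE (g : Metric M) (v : SmoothFun M) : Prop :=
  ∀ x, D.op.toFun M g (fun _ => v) x =
    |v x| ^ ((((ℓ : ℝ) - 1) * n + 4 * k) / ((n : ℝ) - 2 * k)) * v x

/-- The Jacobian determinant of `Φ`, where `ĝ = Φ^* g`, defined by `dvol_ĝ = |J_Φ| dvol_g`: the
quotient of the densities of `ĝ` and `g` in a chart. -/
def jacobian (g ĝ : Metric M) (x : M) : ℝ :=
  chartDensity ĝ (chartAt (E n) x) (chartAt (E n) x x) /
    chartDensity g (chartAt (E n) x) (chartAt (E n) x x)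

/-- `v₁ ∈ v₂ · Conf(M, [g])`: there is a diffeomorphism `Φ` such that `Φ^* g ∈ [g]` and
`v₁ = v₂ · Φ = |J_Φ|^{-w/n} Φ^* v₂`, where `w = -(n-2k)/r`. Two functions are geometrically
distinct if this does not hold. -/
def GeomEquivalent (_D : ConstrainedOp.{u} n ℓ k) (g : Metric M) (v₁ v₂ : SmoothFun M) : Prop :=
  ∃ (Φ : Diffeomorph (𝓡 n) (𝓡 n) M M ∞) (ĝ : Metric M),
    IsPullback (M := M) (N := M) Φ g ĝ ∧ IsConformal g ĝ ∧
      ∀ x, v₁ x = jacobian g ĝ x ^ ((((n : ℝ) - 2 * k) / (ℓ + 1)) / n) * v₂ (Φ x)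

end ConstrainedOp

/-! ### Compact conformal manifolds and their coverings -/

/-- A compact connected conformal `n`-manifold `(M, 𝔠)`. -/
structure CompactConformalManifold (n : ℕ) : Type (u + 1) extends SmoothManifold.{u} n where
  [compact : CompactSpace carrier]
  [connected : ConnectedSpace carrier]
  metrics : Set (Metric toSmoothManifold)
  isConformalClass : ∃ g₀, metrics = {g | IsConformal g₀ g}

/-- The `(D, 𝒞)`-Yamabe constant `inf {𝔇^g(u^{⊗r}) : u ∈ U_𝒞^g, ‖u‖_{r^*} = 1}` as an extended
real number (`+∞` if there is no such `u`). The infimum for a metric `g ∈ 𝔠` does not depend on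
`g`, so it is the same as the infimum over all `g ∈ 𝔠` and all `u`. -/
def ConstrainedOp.yamabeConstant {n ℓ k : ℕ} (D : ConstrainedOp.{u} n ℓ k)
    (M : CompactConformalManifold.{u} n) : EReal :=
  ⨅ g ∈ M.metrics, ⨅ v ∈ {v : SmoothFun M.toSmoothManifold | v ∈ D.cone g ∧ D.critNorm g v = 1},
    ((D.op.dirichlet g (fun _ => v) : ℝ) : EReal)

/-- `π : (N, π^*𝔠) → (M, 𝔠)` is a finite covering of compact connected conformal manifolds; the
manifold structure and the conformal class of `N` are those pulled back by `π`. -/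
structure IsFiniteCovering {n : ℕ} (N M : CompactConformalManifold.{u} n)
    (π : N.toSmoothManifold → M.toSmoothManifold) : Prop where
  isCoveringMap : IsCoveringMap π
  finite_fiber : ∀ x, (π ⁻¹' {x}).Finite
  isLocalDiffeomorph : IsLocalDiffeomorph (𝓡 n) (𝓡 n) ∞ π
  pullback_metrics : ∀ g ∈ M.metrics, ∃ h ∈ N.metrics, IsPullback π g h

/-- Regularity of a covering: the deck transformations act transitively on the fibers. -/
def IsRegularCovering {X Y : Type*} [TopologicalSpace X] (π : X → Y) : Prop :=
  ∀ x y, π x = π y → ∃ Φ : X ≃ₜ X, (∀ z, π (Φ z) = π z) ∧ Φ x = y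

/-- The profinite completion of `π₁(M, x)` is infinite. -/
def HasInfiniteProfiniteFundamentalGroup (X : Type u) [TopologicalSpace X] (x : X) : Prop :=
  Infinite (ProfiniteGrp.ProfiniteCompletion.completion (GrpCat.of (FundamentalGroup X x)))

end ConformalYamabe

end

open ConformalYamabe

/-! The invariant that separates solutions is the critical energy `E(v) = ∫ |v|^{r*} dvol`.
Conformal diffeomorphisms, acting with the weight in the definition of geometric equivalence,
preserve it (`GeomEquivalent.critEnergy_eq`), so solutions with different energies are geometrically
distinct. Pulling back along a covering of degree `d` preserves the cone and the equation, because
natural operators commute with local isometries (`PolydiffOp.toFun_pullback`), and multiplies the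
energy by `d` (`critEnergy_pullback`).

Let `k > 0`. Pairing the equation with `v` shows that the Dirichlet form of a solution equals its
energy. After normalization, positivity of the Yamabe constant therefore bounds the energies of all
nonzero solutions in the cone below by some `δ > 0`, which depends on the conformal manifold but not
on the metric in its class (`exists_le_critEnergy`). The second hypothesis supplies on every
covering a solution of energy at most `Λ^{r*}`, the same bound for all coverings.

Infinitude of the profinite completion of `G = π₁(M)` yields normal subgroups of arbitrarily large
finite index below any given one (`exists_le_index_lt`). Hence there is a descending chain `H 0 ≥ H
1 ≥ …` with `Λ^{r*} / [G : H (i+1)] < δ (H i) / [G : H i]` (`exists_chain_index`), so that energy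
divided by degree strictly decreases along the chain. Lifting the solutions of levels `0, …, m-1` to
the covering of `H m` multiplies all these quotients by the same factor `[G : H m]`, and `m`
distinct energies result. The chain is fixed before the metric `g` is chosen.

For `k = 0` the energy bound degenerates, but the equation is then homogeneous, and positive
multiples of one solution have distinct energies.

The coverings are built without a universal cover: for a finite quotient `Q` of `G`, the bundle with
discrete fiber `Q` is glued from left multiplications by holonomies of loops
(`SimpleNeighborhoods.core`). Equivariant maps of fibers induce both the deck transformations and
the maps between levels of the tower. -/

noncomputable section

namespace ConformalYamabe

/-! ### Riemannian metrics in charts -/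

section Differential

variable {n : ℕ} {X Y Z : Type*} [TopologicalSpace X] [ChartedSpace (E n) X]
  [TopologicalSpace Y] [ChartedSpace (E n) Y] [TopologicalSpace Z] [ChartedSpace (E n) Z]

/-- The differential of a map between `n`-manifolds as an endomorphism of the model space. -/
def dmap (f : X → Y) (x : X) : E n →L[ℝ] E n := mfderiv (𝓡 n) (𝓡 n) f x

lemma dmap_comp {f : Y → Z} {k : X → Y} {x : X} (hf : MDifferentiableAt (𝓡 n) (𝓡 n) f (k x))
    (hk : MDifferentiableAt (𝓡 n) (𝓡 n) k x) :
    dmap (n := n) (f ∘ k) x = (dmap f (k x)).comp (dmap k x) :=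
  mfderiv_comp x hf hk

lemma dmap_congr {f k : X → Y} {x : X} (h : f =ᶠ[𝓝 x] k) :
    dmap (n := n) f x = dmap k x :=
  h.mfderiv_eq

lemma dmap_id (x : X) : dmap (id : X → X) x = ContinuousLinearMap.id ℝ (E n) := mfderiv_id

lemma dmap_eq_fderiv (f : E n → E n) (x : E n) : dmap f x = fderiv ℝ f x := mfderiv_eq_fderiv

end Differential

section Charts

variable {n : ℕ} {M N : SmoothManifold.{u} n}

/-- A metric at a point as a bilinear form on the model space. -/
def metricForm (g : Metric M) (x : M) : E n →L[ℝ] E n →L[ℝ] ℝ := g.inner x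

lemma isPullback_iff {p : N → M} {g : Metric M} {h : Metric N} : IsPullback p g h ↔
    ∀ x (v w : E n), metricForm h x v w = metricForm g (p x) (dmap p x v) (dmap p x w) := Iff.rfl

lemma mdifferentiableAt_chart {φ : OpenPartialHomeomorph M (E n)} (hφ : φ ∈ smoothCharts M)
    {x : M} (hx : x ∈ φ.source) : MDifferentiableAt (𝓡 n) (𝓡 n) φ x :=
  (contMDiffAt_of_mem_maximalAtlas hφ hx).mdifferentiableAt (by simp)

lemma mdifferentiableAt_chart_symm {φ : OpenPartialHomeomorph M (E n)} (hφ : φ ∈ smoothCharts M)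
    {y : E n} (hy : y ∈ φ.target) : MDifferentiableAt (𝓡 n) (𝓡 n) φ.symm y :=
  (contMDiffAt_symm_of_mem_maximalAtlas hφ hy).mdifferentiableAt (by simp)

/-- The coordinate expression of `p` is differentiable. -/
lemma differentiableAt_coord {p : N → M} {φ : OpenPartialHomeomorph M (E n)}
    (hφ : φ ∈ smoothCharts M) {ψ : OpenPartialHomeomorph N (E n)} (hψ : ψ ∈ smoothCharts N)
    {y : E n} (hy : y ∈ ψ.target) (hpy : p (ψ.symm y) ∈ φ.source)
    (hp : MDifferentiableAt (𝓡 n) (𝓡 n) p (ψ.symm y)) :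
    DifferentiableAt ℝ (fun z => φ (p (ψ.symm z))) y := by
  rw [← mdifferentiableAt_iff_differentiableAt]
  exact (mdifferentiableAt_chart hφ hpy).comp y (hp.comp y (mdifferentiableAt_chart_symm hψ hy))

/-- The coordinate vector field as a vector of the model space. -/
def coordVec (φ : OpenPartialHomeomorph M (E n)) (y : E n) (i : Fin n) : E n :=
  dmap φ.symm y (EuclideanSpace.single i (1 : ℝ))

lemma metricMatrix_apply (g : Metric M) (φ : OpenPartialHomeomorph M (E n)) (y : E n)
    (i j : Fin n) : metricMatrix g φ y i j =
      metricForm g (φ.symm y) (coordVec φ y i) (coordVec φ y j) := rfl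

/-- Chain rule for the coordinate vector fields. -/
lemma dmap_coordVec {p : N → M} {φ : OpenPartialHomeomorph M (E n)}
    (hφ : φ ∈ smoothCharts M) {ψ : OpenPartialHomeomorph N (E n)} (hψ : ψ ∈ smoothCharts N)
    {y : E n} (hy : y ∈ ψ.target) (hpy : p (ψ.symm y) ∈ φ.source)
    (hp : MDifferentiableAt (𝓡 n) (𝓡 n) p (ψ.symm y)) (i : Fin n) :
    dmap p (ψ.symm y) (coordVec ψ y i) =
      ∑ j, (fderiv ℝ (fun z => φ (p (ψ.symm z))) y (EuclideanSpace.single i (1 : ℝ))) j •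
        coordVec φ (φ (p (ψ.symm y))) j := by
  have hd := differentiableAt_coord hφ hψ hy hpy hp
  have h1 := dmap_comp hp (mdifferentiableAt_chart_symm hψ hy)
  have h2 := dmap_comp (k := fun z => φ (p (ψ.symm z)))
    (mdifferentiableAt_chart_symm hφ (φ.map_source hpy)) hd.mdifferentiableAt
  rw [dmap_eq_fderiv] at h2
  have hcy : ContinuousAt (fun z => p (ψ.symm z)) y :=
    hp.continuousAt.comp (f := ψ.symm) (ψ.symm.continuousAt hy)
  have h3 : (p ∘ ψ.symm) =ᶠ[𝓝 y] (φ.symm ∘ (fun z => φ (p (ψ.symm z)))) := by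
    filter_upwards [hcy.preimage_mem_nhds (φ.open_source.mem_nhds hpy)] with z hz
    exact (φ.left_inv hz).symm
  have h5 := congrArg (fun L : E n →L[ℝ] E n => L (EuclideanSpace.single i (1 : ℝ)))
    ((h1.symm.trans (dmap_congr h3)).trans h2)
  refine Eq.trans h5 ?_
  simp only [ContinuousLinearMap.comp_apply]
  set w := fderiv ℝ (fun z => φ (p (ψ.symm z))) y (EuclideanSpace.single i (1 : ℝ)) with hw
  have h6 : w = ∑ j, w j • (EuclideanSpace.single j (1 : ℝ) : E n) := by
    have := (EuclideanSpace.basisFun (Fin n) ℝ).sum_repr w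
    simpa using this.symm
  conv_lhs => rw [h6]
  rw [map_sum]
  exact Finset.sum_congr rfl fun j _ => map_smul _ _ _

/-- The Jacobian matrix of a map `E n → E n`. -/
def jacobianMatrix (f : E n → E n) (y : E n) : Matrix (Fin n) (Fin n) ℝ :=
  Matrix.of fun j i => fderiv ℝ f y (EuclideanSpace.single i (1 : ℝ)) j

lemma det_jacobianMatrix (f : E n → E n) (y : E n) :
    (jacobianMatrix f y).det = (fderiv ℝ f y).det := by
  have : jacobianMatrix f y = LinearMap.toMatrix (EuclideanSpace.basisFun (Fin n) ℝ).toBasis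
      (EuclideanSpace.basisFun (Fin n) ℝ).toBasis (fderiv ℝ f y : E n →ₗ[ℝ] E n) := by
    ext i j
    simp [jacobianMatrix, LinearMap.toMatrix_apply]
  rw [this, LinearMap.det_toMatrix]

lemma metricMatrix_pullback {p : N → M} {g : Metric M} {h : Metric N} (hpb : IsPullback p g h)
    {φ : OpenPartialHomeomorph M (E n)}
    (hφ : φ ∈ smoothCharts M) {ψ : OpenPartialHomeomorph N (E n)} (hψ : ψ ∈ smoothCharts N)
    {y : E n} (hy : y ∈ ψ.target) (hpy : p (ψ.symm y) ∈ φ.source)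
    (hp : MDifferentiableAt (𝓡 n) (𝓡 n) p (ψ.symm y)) :
    metricMatrix h ψ y =
      (jacobianMatrix (fun z => φ (p (ψ.symm z))) y).transpose *
        metricMatrix g φ (φ (p (ψ.symm y))) * jacobianMatrix (fun z => φ (p (ψ.symm z))) y := by
  ext i j
  have hx : p (ψ.symm y) = φ.symm (φ (p (ψ.symm y))) := (φ.left_inv hpy).symm
  rw [metricMatrix_apply, isPullback_iff.1 hpb, dmap_coordVec hφ hψ hy hpy hp i,
    dmap_coordVec hφ hψ hy hpy hp j]
  have hB : metricForm g (p (ψ.symm y)) = metricForm g (φ.symm (φ (p (ψ.symm y)))) :=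
    congrArg _ hx
  rw [hB]
  simp only [map_sum, map_smul, sum_apply, smul_apply,
    Matrix.mul_apply, Matrix.transpose_apply, Finset.sum_mul, smul_eq_mul]
  refine Finset.sum_congr rfl fun a _ => ?_
  rw [Finset.mul_sum]
  refine Finset.sum_congr rfl fun b _ => ?_
  rw [metricMatrix_apply]
  simp only [jacobianMatrix, Matrix.of_apply]
  ring

lemma continuousOn_metricMatrix (g : Metric M) {φ : OpenPartialHomeomorph M (E n)}
    (hφ : φ ∈ smoothCharts M) : ContinuousOn (metricMatrix g φ) φ.target := by
  have hv : ∀ i : Fin n, ContinuousOn (fun y => (⟨φ.symm y, coordVector φ y i⟩ :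
      TangentBundle (𝓡 n) M)) φ.target := by
    intro i
    have h1 := (contMDiffOn_symm_of_mem_maximalAtlas hφ).continuousOn_tangentMapWithin
      (by simp) φ.open_target.uniqueMDiffOn
    -- The coordinate field is the image of a constant vector field under the tangent map of
    -- `φ.symm`, which gives its continuity as a section of the tangent bundle.
    have h2 : Continuous (fun y : E n => (⟨y, EuclideanSpace.single i (1 : ℝ)⟩ :
        TangentBundle (𝓡 n) (E n))) := by
      have h := (contMDiff_vectorSpace_iff_contDiff (𝕜 := ℝ) (E := E n) (n := 0)
        (V := fun _ => (EuclideanSpace.single i (1 : ℝ) : E n))).2 contDiff_const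
      exact h.continuous
    have h3 := h1.comp (s := φ.target) h2.continuousOn (fun y hy => hy)
    refine h3.congr fun y hy => ?_
    simp only [Function.comp, tangentMapWithin, mfderivWithin_of_isOpen φ.open_target hy]
    rfl
  refine continuousOn_pi.2 fun i => continuousOn_pi.2 fun j => fun y hy => ?_
  have hg : ContinuousWithinAt (fun z => (⟨φ.symm z, g.inner (φ.symm z)⟩ :
      Bundle.TotalSpace (E n →L[ℝ] E n →L[ℝ] ℝ)
        (fun b : M => TangentSpace (𝓡 n) b →L[ℝ] TangentSpace (𝓡 n) b →L[ℝ] ℝ))) φ.target y :=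
    g.contMDiff.continuous.continuousAt.comp_continuousWithinAt
      (φ.symm.continuousAt hy).continuousWithinAt
  have : ContinuousWithinAt (fun z => Bundle.TotalSpace.mk' ℝ (E := Bundle.Trivial M ℝ) (φ.symm z)
      (g.inner (φ.symm z) (coordVector φ z i) (coordVector φ z j))) φ.target y :=
    hg.clm_bundle_apply₂ (F₁ := E n) (F₂ := E n) (hv i y hy) (hv j y hy)
  simp only [FiberBundle.continuousWithinAt_totalSpace] at this
  exact this.2

lemma continuousOn_chartDensity (g : Metric M) {φ : OpenPartialHomeomorph M (E n)}
    (hφ : φ ∈ smoothCharts M) : ContinuousOn (chartDensity g φ) φ.target :=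
  Real.continuous_sqrt.comp_continuousOn
    ((Continuous.matrix_det continuous_id).comp_continuousOn (continuousOn_metricMatrix g hφ))

end Charts

/-! ### The Riemannian volume measure -/

section Volume

variable {n : ℕ} {M N : SmoothManifold.{u} n}

open scoped ENNReal

lemma measurableSet_target_inter (φ : OpenPartialHomeomorph M (E n)) {B : Set M}
    (hB : MeasurableSet B) : MeasurableSet (φ.target ∩ φ.symm ⁻¹' B) := by
  have h : Measurable (φ.target.domRestrict φ.symm) :=
    (continuousOn_iff_continuous_domRestrict.1 φ.continuousOn_symm).measurable
  have h2 := φ.open_target.measurableSet.subtype_image (h hB)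
  convert h2 using 1
  ext y
  simp [Set.domRestrict, and_comm]

lemma aemeasurable_chart_symm (g : Metric M) (φ : OpenPartialHomeomorph M (E n)) :
    AEMeasurable φ.symm ((volume.restrict φ.target).withDensity
      (fun y => ENNReal.ofReal (chartDensity g φ y))) :=
  (φ.continuousOn_symm.aemeasurable φ.open_target.measurableSet).mono_ac
    (withDensity_absolutelyContinuous _ _)

lemma chartVolume_apply (g : Metric M) (φ : OpenPartialHomeomorph M (E n)) {B : Set M}
    (hB : MeasurableSet B) : chartVolume g φ B =
      ∫⁻ y in φ.target ∩ φ.symm ⁻¹' B, ENNReal.ofReal (chartDensity g φ y) := by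
  have hT := measurableSet_target_inter φ hB
  rw [chartVolume, Measure.map_apply_of_aemeasurable (aemeasurable_chart_symm g φ) hB]
  have h1 : ((volume.restrict φ.target).withDensity
      (fun y => ENNReal.ofReal (chartDensity g φ y))) φ.targetᶜ = 0 := by
    rw [withDensity_apply _ φ.open_target.measurableSet.compl,
      Measure.restrict_restrict φ.open_target.measurableSet.compl]
    simp
  rw [← measure_inter_add_sdiff₀ _ φ.open_target.measurableSet.nullMeasurableSet,
    measure_mono_null (s := _ \ _) (fun y hy => hy.2) h1, add_zero, inter_comm, withDensity_apply _ hT,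
    Measure.restrict_restrict hT, inter_eq_left.2 inter_subset_left]

lemma dmap_chart_symm_injective {φ : OpenPartialHomeomorph M (E n)} (hφ : φ ∈ smoothCharts M)
    {y : E n} (hy : y ∈ φ.target) : Function.Injective (dmap φ.symm y : E n →L[ℝ] E n) := by
  have h1 := dmap_comp (mdifferentiableAt_chart hφ (φ.map_target hy))
    (mdifferentiableAt_chart_symm hφ hy)
  have h2 : dmap (n := n) (φ ∘ φ.symm) y = dmap id y := by
    refine dmap_congr ?_
    filter_upwards [φ.open_target.mem_nhds hy] with z hz using φ.right_inv hz
  rw [dmap_id] at h2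
  have h3 := h1.symm.trans h2
  exact Function.LeftInverse.injective (g := dmap φ (φ.symm y))
    fun v => congrArg (fun L : E n →L[ℝ] E n => L v) h3

lemma metricForm_pos (g : Metric M) (x : M) {v : E n} (hv : v ≠ 0) : 0 < metricForm g x v v :=
  g.pos x v hv

lemma metricForm_symm (g : Metric M) (x : M) (v w : E n) :
    metricForm g x v w = metricForm g x w v :=
  g.symm x v w

lemma metricMatrix_posDef (g : Metric M) {φ : OpenPartialHomeomorph M (E n)}
    (hφ : φ ∈ smoothCharts M) {y : E n} (hy : y ∈ φ.target) : (metricMatrix g φ y).PosDef := by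
  refine Matrix.PosDef.of_dotProduct_mulVec_pos ?_ fun v hv => ?_
  · ext i j
    exact metricForm_symm g _ _ _
  · have h0 : (WithLp.toLp 2 v : E n) ≠ 0 := by simpa using hv
    have h1 : dmap φ.symm y (WithLp.toLp 2 v : E n) ≠ 0 := fun h =>
      h0 (dmap_chart_symm_injective hφ hy (h.trans (map_zero _).symm))
    have h2 : dmap φ.symm y (WithLp.toLp 2 v : E n) = ∑ i, v i • coordVec φ y i := by
      have h6 : (WithLp.toLp 2 v : E n) = ∑ j, v j • (EuclideanSpace.single j (1 : ℝ) : E n) := by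
        have := (EuclideanSpace.basisFun (Fin n) ℝ).sum_repr (WithLp.toLp 2 v : E n)
        simpa using this.symm
      conv_lhs => rw [h6]
      rw [map_sum]
      exact Finset.sum_congr rfl fun j _ => map_smul _ _ _
    have h3 := metricForm_pos g (φ.symm y) h1
    rw [h2] at h3
    refine h3.trans_eq ?_
    simp only [map_sum, map_smul, sum_apply, smul_apply, dotProduct, Matrix.mulVec, smul_eq_mul,
      metricMatrix_apply, star_trivial, Finset.mul_sum]
    refine Finset.sum_congr rfl fun i _ => Finset.sum_congr rfl fun j _ => ?_
    rw [metricForm_symm g]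
    ring

lemma chartDensity_pos (g : Metric M) {φ : OpenPartialHomeomorph M (E n)}
    (hφ : φ ∈ smoothCharts M) {y : E n} (hy : y ∈ φ.target) : 0 < chartDensity g φ y :=
  Real.sqrt_pos.2 (metricMatrix_posDef g hφ hy).det_pos

/-- Since `det (Jᵀ G J) = (det J)² det G`, the square root produces exactly the factor in the change
of variables formula. -/
lemma chartDensity_pullback {p : N → M} {g : Metric M} {h : Metric N} (hpb : IsPullback p g h)
    {φ : OpenPartialHomeomorph M (E n)}
    (hφ : φ ∈ smoothCharts M) {ψ : OpenPartialHomeomorph N (E n)} (hψ : ψ ∈ smoothCharts N)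
    {y : E n} (hy : y ∈ ψ.target) (hpy : p (ψ.symm y) ∈ φ.source)
    (hp : MDifferentiableAt (𝓡 n) (𝓡 n) p (ψ.symm y)) :
    chartDensity h ψ y = |(fderiv ℝ (fun z => φ (p (ψ.symm z))) y).det| *
      chartDensity g φ (φ (p (ψ.symm y))) := by
  rw [chartDensity, metricMatrix_pullback hpb hφ hψ hy hpy hp, Matrix.det_mul, Matrix.det_mul,
    Matrix.det_transpose, det_jacobianMatrix, chartDensity, ← Real.sqrt_sq_eq_abs,
    ← Real.sqrt_mul (sq_nonneg _)]
  congr 1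
  ring

/-- A local isometry that is injective on `V` maps volume to volume. -/
lemma chartVolume_pullback {p : N → M} {g : Metric M} {h : Metric N} (hpb : IsPullback p g h)
    {φ : OpenPartialHomeomorph M (E n)}
    (hφ : φ ∈ smoothCharts M) {ψ : OpenPartialHomeomorph N (E n)} (hψ : ψ ∈ smoothCharts N)
    (hp : MDifferentiable (𝓡 n) (𝓡 n) p) {V : Set N} (hV : IsOpen V) (hVψ : V ⊆ ψ.source)
    (hVφ : MapsTo p V φ.source) (hinj : InjOn p V) {B : Set M} (hB : MeasurableSet B)
    (hBV : B ⊆ p '' V) :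
    chartVolume h ψ (V ∩ p ⁻¹' B) = chartVolume g φ B := by
  have hpc : Continuous p := continuous_iff_continuousAt.2 fun x => (hp x).continuousAt
  have hVB : MeasurableSet (V ∩ p ⁻¹' B) := hV.measurableSet.inter (hpc.measurable hB)
  rw [chartVolume_apply h ψ hVB, chartVolume_apply g φ hB]
  set s := ψ.target ∩ ψ.symm ⁻¹' (V ∩ p ⁻¹' B)
  have hs : MeasurableSet s := measurableSet_target_inter ψ hVB
  set τ : E n → E n := fun z => φ (p (ψ.symm z))
  have hτs : φ.target ∩ φ.symm ⁻¹' B = τ '' s := by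
    ext z
    constructor
    · rintro ⟨hz, hzB⟩
      obtain ⟨v, hv, hvz⟩ := hBV hzB
      refine ⟨ψ v, ⟨ψ.map_source (hVψ hv), ?_⟩, ?_⟩
      · change ψ.symm (ψ v) ∈ V ∩ p ⁻¹' B
        rw [ψ.left_inv (hVψ hv)]
        exact ⟨hv, by rw [mem_preimage, hvz]; exact hzB⟩
      · change φ (p (ψ.symm (ψ v))) = z
        rw [ψ.left_inv (hVψ hv), hvz, φ.right_inv hz]
    · rintro ⟨y, ⟨hy, hyV, hyB⟩, rfl⟩
      refine ⟨φ.map_source (hVφ hyV), ?_⟩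
      change φ.symm (φ (p (ψ.symm y))) ∈ B
      rw [φ.left_inv (hVφ hyV)]
      exact hyB
  have hτinj : InjOn τ s := by
    intro y hy z hz hyz
    have h1 := φ.injOn (hVφ hy.2.1) (hVφ hz.2.1) hyz
    exact ψ.symm.injOn hy.1 hz.1 (hinj hy.2.1 hz.2.1 h1)
  have hder : ∀ y ∈ s, HasFDerivWithinAt τ (fderiv ℝ τ y) s y := fun y hy =>
    (differentiableAt_coord hφ hψ hy.1 (hVφ hy.2.1) (hp _)).hasFDerivAt.hasFDerivWithinAt
  rw [hτs, lintegral_image_eq_lintegral_abs_det_fderiv_mul volume hs hder hτinj]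
  refine setLIntegral_congr_fun hs fun y hy => ?_
  rw [chartDensity_pullback hpb hφ hψ hy.1 (hVφ hy.2.1) (hp _), ENNReal.ofReal_mul (abs_nonneg _)]

lemma isPullback_id (g : Metric M) : IsPullback id g g :=
  isPullback_iff.2 fun x v w => by simp [dmap_id]

/-- Independence of the chart is the case of the identity map, viewed as a local isometry. -/
lemma chartVolume_eq_of_subset (g : Metric M) {φ ψ : OpenPartialHomeomorph M (E n)}
    (hφ : φ ∈ smoothCharts M) (hψ : ψ ∈ smoothCharts M) {B : Set M} (hB : MeasurableSet B)
    (hBφ : B ⊆ φ.source) (hBψ : B ⊆ ψ.source) : chartVolume g ψ B = chartVolume g φ B := by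
  have h := chartVolume_pullback (isPullback_id g) hφ hψ mdifferentiable_id
    (ψ.open_source.inter φ.open_source) inter_subset_left (fun x hx => hx.2) (injOn_id _) hB
    (by rw [image_id]; exact subset_inter hBψ hBφ)
  rwa [preimage_id, inter_eq_right.2 (subset_inter hBψ hBφ)] at h

lemma chartVolume_le_vol (g : Metric M) {φ : OpenPartialHomeomorph M (E n)}
    (hφ : φ ∈ smoothCharts M) : chartVolume g φ ≤ vol g :=
  le_iSup₂ (f := fun φ (_ : φ ∈ smoothCharts M) => chartVolume g φ) φ hφ

lemma chartVolume_compl_source (g : Metric M) (φ : OpenPartialHomeomorph M (E n)) :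
    chartVolume g φ φ.sourceᶜ = 0 := by
  rw [chartVolume_apply g φ φ.open_source.measurableSet.compl]
  have : φ.target ∩ φ.symm ⁻¹' φ.sourceᶜ = ∅ := by
    ext y
    simp only [mem_inter_iff, mem_preimage, mem_compl_iff, mem_empty_iff_false, iff_false, not_and,
      not_not]
    exact fun hy => φ.map_target hy
  rw [this, Measure.restrict_empty, lintegral_zero_measure]

/-- Each `chartVolume g ψ` obeys this bound, since it agrees with `chartVolume g φ` on the overlap
of the charts and vanishes off `ψ.source`; the supremum then obeys it too. Inside `φ.source` the
second summand disappears. -/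
lemma vol_le (g : Metric M) {φ : OpenPartialHomeomorph M (E n)} (hφ : φ ∈ smoothCharts M) :
    vol g ≤ chartVolume g φ + (vol g).restrict φ.sourceᶜ := by
  refine iSup₂_le fun ψ hψ => Measure.le_iff.2 fun A hA => ?_
  have hs := φ.open_source.measurableSet
  rw [Measure.add_apply, Measure.restrict_apply hA, ← measure_inter_add_sdiff A hs]
  refine add_le_add ?_ (chartVolume_le_vol g hψ _)
  have h1 : chartVolume g ψ (A ∩ φ.source) = chartVolume g ψ (A ∩ φ.source ∩ ψ.source) := by
    rw [← measure_inter_add_sdiff (A ∩ φ.source) ψ.open_source.measurableSet]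
    rw [measure_mono_null (s := _ \ _) (fun y hy => hy.2) (chartVolume_compl_source g ψ), add_zero]
  rw [h1, chartVolume_eq_of_subset g hφ hψ ((hA.inter hs).inter ψ.open_source.measurableSet)
    (fun x hx => hx.1.2) (fun x hx => hx.2)]
  exact measure_mono fun x hx => hx.1.1

/-- The volume measure is given by any chart on its domain. -/
lemma vol_apply_of_subset (g : Metric M) {φ : OpenPartialHomeomorph M (E n)}
    (hφ : φ ∈ smoothCharts M) {B : Set M} (hB : MeasurableSet B) (hBφ : B ⊆ φ.source) :
    vol g B = chartVolume g φ B := by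
  refine le_antisymm ?_ (chartVolume_le_vol g hφ B)
  have h := vol_le g hφ B
  rwa [Measure.add_apply, Measure.restrict_apply hB,
    (disjoint_compl_right_iff_subset.2 hBφ).inter_eq, measure_empty, add_zero] at h

/-- A local isometry with all fibers of cardinality `d` multiplies volumes by `d`. -/
lemma map_vol_eq_smul {p : N → M} (hp : IsLocalDiffeomorph (𝓡 n) (𝓡 n) ∞ p) {g : Metric M}
    {h : Metric N} (hpb : IsPullback p g h) {d : ℕ}
    (hfin : ∀ x, (p ⁻¹' {x}).Finite) (hd : ∀ x, (p ⁻¹' {x}).ncard = d) :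
    (vol h).map p = (d : ℝ≥0∞) • vol g := by
  have hpc : Continuous p := hp.contMDiff.continuous
  have hlocal : ∀ x : M, ∃ U : Set M, IsOpen U ∧ x ∈ U ∧ ∀ B, MeasurableSet B → B ⊆ U →
      vol h (p ⁻¹' B) = d * vol g B := by
    intro x
    obtain ⟨W, hW, hWd⟩ := (hfin x).t2_separation
    choose Φ hΦ using fun s : N => hp s
    set V : N → Set N := fun s =>
      W s ∩ ((Φ s).source ∩ (chartAt (E n) s).source) ∩ p ⁻¹' (chartAt (E n) x).source with hV
    have hVo : ∀ s, IsOpen (V s) := fun s =>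
      ((hW s).2.inter ((Φ s).open_source.inter (chartAt (E n) s).open_source)).inter
        ((chartAt (E n) x).open_source.preimage hpc)
    have hsV : ∀ s ∈ p ⁻¹' {x}, s ∈ V s := fun s hs =>
      ⟨⟨(hW s).1, (hΦ s).1, mem_chart_source _ s⟩, by
        rw [mem_preimage, show p s = x from hs]; exact mem_chart_source _ x⟩
    have hinj : ∀ s, InjOn p (V s) := fun s y hy z hz hyz => by
      refine (Φ s).injOn hy.1.2.1 hz.1.2.1 ?_
      exact ((hΦ s).2 hy.1.2.1).symm.trans (hyz.trans ((hΦ s).2 hz.1.2.1))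
    have hopen : IsOpenMap p := hp.isOpenMap
    have hVdisj : (p ⁻¹' {x}).PairwiseDisjoint V := hWd.mono fun s y hy => hy.1.1
    refine ⟨⋂ s ∈ p ⁻¹' {x}, p '' V s ∩ (chartAt (E n) x).source,
      (hfin x).isOpen_biInter fun s _ => (hopen _ (hVo s)).inter (chartAt (E n) x).open_source,
      mem_iInter₂.2 fun s hs => ⟨⟨s, hsV s hs, hs⟩, mem_chart_source _ x⟩, fun B hB hBU => ?_⟩
    have hBV : ∀ s ∈ p ⁻¹' {x}, B ⊆ p '' V s := fun s hs y hy => (mem_iInter₂.1 (hBU hy) s hs).1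
    -- A point of `B` has a preimage in each of the `d` disjoint sheets `V s`. As its fiber has only
    -- `d` points, these are all of its preimages.
    have hsplit : p ⁻¹' B = ⋃ s ∈ p ⁻¹' {x}, (V s ∩ p ⁻¹' B) := by
      refine Subset.antisymm (fun z hz => ?_) (iUnion₂_subset fun s _ => inter_subset_right)
      have hz' : p z ∈ B := hz
      choose! q hqV hqz using fun s (hs : s ∈ p ⁻¹' {x}) => hBV s hs hz'
      have hqinj : InjOn q (p ⁻¹' {x}) := by
        intro s hs t ht hst
        by_contra hne
        exact (disjoint_left.1 (hVdisj hs ht hne)) (hqV s hs) (hst ▸ hqV t ht)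
      have hsub : q '' (p ⁻¹' {x}) ⊆ p ⁻¹' {p z} := by
        rintro _ ⟨s, hs, rfl⟩
        exact hqz s hs
      have heq : q '' (p ⁻¹' {x}) = p ⁻¹' {p z} := by
        refine eq_of_subset_of_ncard_le hsub ?_ (hfin _)
        rw [hqinj.ncard_image, hd, hd]
      have : z ∈ q '' (p ⁻¹' {x}) := heq ▸ (rfl : p z = p z)
      obtain ⟨s, hs, rfl⟩ := this
      exact mem_iUnion₂.2 ⟨s, hs, hqV s hs, hz⟩
    have hVB : ∀ s, MeasurableSet (V s ∩ p ⁻¹' B) := fun s =>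
      (hVo s).measurableSet.inter (hpc.measurable hB)
    have hterm : ∀ s ∈ (hfin x).toFinset, vol h (V s ∩ p ⁻¹' B) = vol g B := by
      intro s hs
      have hs : s ∈ p ⁻¹' {x} := (hfin x).mem_toFinset.1 hs
      rw [vol_apply_of_subset h (IsManifold.chart_mem_maximalAtlas s) (hVB s)
          (fun y hy => hy.1.1.2.2),
        chartVolume_pullback hpb (IsManifold.chart_mem_maximalAtlas x)
          (IsManifold.chart_mem_maximalAtlas s) (hp.mdifferentiable (by simp)) (hVo s)
          (fun y hy => hy.1.2.2) (fun y hy => hy.2) (hinj s) hB (hBV s hs)]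
      by_cases hne : (p ⁻¹' {x}).Nonempty
      · refine (vol_apply_of_subset g (IsManifold.chart_mem_maximalAtlas x) hB fun y hy => ?_).symm
        exact (mem_iInter₂.1 (hBU hy) s hs).2
      · exact absurd ⟨s, hs⟩ hne
    have hU : (⋃ s ∈ p ⁻¹' {x}, (V s ∩ p ⁻¹' B)) =
        ⋃ s ∈ (hfin x).toFinset, (V s ∩ p ⁻¹' B) := by simp
    rw [hsplit, hU, measure_biUnion_finset, Finset.sum_congr rfl hterm, Finset.sum_const,
      ← ncard_eq_toFinset_card _ (hfin x), hd, nsmul_eq_mul]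
    · rw [Finite.coe_toFinset]
      exact hVdisj.mono fun s => inter_subset_left
    · exact fun s _ => hVB s
  choose U hUo hxU hU using hlocal
  obtain ⟨T, hTc, hT⟩ := TopologicalSpace.countable_cover_nhds fun x => (hUo x).mem_nhds (hxU x)
  refine Measure.ext_of_biUnion_eq_univ hTc hT fun x _ => Measure.ext fun B hB => ?_
  rw [Measure.restrict_apply hB, Measure.restrict_apply hB,
    Measure.map_apply hpc.measurable (hB.inter (hUo x).measurableSet), Measure.smul_apply,
    hU x _ (hB.inter (hUo x).measurableSet) inter_subset_right, smul_eq_mul]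

lemma aemeasurable_chartDensity (g : Metric M) {φ : OpenPartialHomeomorph M (E n)}
    (hφ : φ ∈ smoothCharts M) {S : Set (E n)} (hS : MeasurableSet S) (hSφ : S ⊆ φ.target) :
    AEMeasurable (fun y => ENNReal.ofReal (chartDensity g φ y)) (volume.restrict S) :=
  (((continuousOn_chartDensity g hφ).mono hSφ).aemeasurable hS).ennreal_ofReal

lemma vol_ne_zero_of_isOpen (g : Metric M) {U : Set M} (hU : IsOpen U) (hne : U.Nonempty) :
    vol g U ≠ 0 := by
  obtain ⟨x, hx⟩ := hne
  have hφ : chartAt (E n) x ∈ smoothCharts M := IsManifold.chart_mem_maximalAtlas x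
  have hxs : x ∈ (chartAt (E n) x).source := mem_chart_source _ x
  set φ := chartAt (E n) x
  intro h0
  have h1 : chartVolume g φ U = 0 := le_antisymm (h0 ▸ chartVolume_le_vol g hφ U) zero_le
  have hS := measurableSet_target_inter φ hU.measurableSet
  have hSo : IsOpen (φ.target ∩ φ.symm ⁻¹' U) := φ.symm.isOpen_inter_preimage hU
  rw [chartVolume_apply g φ hU.measurableSet, lintegral_eq_zero_iff'
    (aemeasurable_chartDensity g hφ hS inter_subset_left), Filter.EventuallyEq,
    ae_restrict_iff' hS] at h1
  refine hSo.measure_ne_zero volume ⟨φ x, φ.map_source hxs, ?_⟩ (measure_mono_null ?_ h1)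
  · rw [mem_preimage, φ.left_inv hxs]; exact hx
  · intro y hy
    simp only [mem_compl_iff, mem_ofPred_eq, not_forall]
    refine ⟨hy, ?_⟩
    simpa using chartDensity_pos g hφ hy.1

instance vol_isFiniteMeasure [CompactSpace M] (g : Metric M) : IsFiniteMeasure (vol g) := by
  have : IsLocallyFiniteMeasure (vol g) := by
    refine ⟨fun x => ?_⟩
    have hφ : chartAt (E n) x ∈ smoothCharts M := IsManifold.chart_mem_maximalAtlas x
    have hxs : x ∈ (chartAt (E n) x).source := mem_chart_source _ x
    set φ := chartAt (E n) x
    obtain ⟨K, hK, hxK, hKt⟩ := exists_compact_subset φ.open_target (φ.map_source hxs)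
    have hAo : IsOpen (φ.source ∩ φ ⁻¹' interior K) := φ.isOpen_inter_preimage isOpen_interior
    refine ⟨φ.source ∩ φ ⁻¹' interior K, hAo.mem_nhds ⟨hxs, hxK⟩, ?_⟩
    rw [vol_apply_of_subset g hφ hAo.measurableSet inter_subset_left,
      chartVolume_apply g φ hAo.measurableSet]
    have hsub : φ.target ∩ φ.symm ⁻¹' (φ.source ∩ φ ⁻¹' interior K) ⊆ K := fun y hy => by
      have := hy.2.2
      rw [mem_preimage, φ.right_inv hy.1] at this
      exact interior_subset this
    obtain ⟨C, hC⟩ := (hK.image_of_continuousOn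
      ((continuousOn_chartDensity g hφ).mono hKt)).bddAbove
    calc _ ≤ ∫⁻ y in K, ENNReal.ofReal (chartDensity g φ y) := lintegral_mono_set hsub
      _ ≤ ∫⁻ y in K, ENNReal.ofReal C := setLIntegral_mono' hK.measurableSet fun y hy =>
          ENNReal.ofReal_le_ofReal (hC ⟨y, hy, rfl⟩)
      _ < ⊤ := by
        rw [setLIntegral_const]
        exact ENNReal.mul_lt_top ENNReal.ofReal_lt_top hK.measure_lt_top
  infer_instance

/-! ### Conformal changes -/

lemma metricMatrix_conformal {g ĝ : Metric M} {Υ : SmoothFun M} (h : IsConformalChange g ĝ Υ)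
    (φ : OpenPartialHomeomorph M (E n)) (y : E n) :
    metricMatrix ĝ φ y = Real.exp (2 * Υ (φ.symm y)) • metricMatrix g φ y := by
  ext i j
  exact h _ _ _

lemma chartDensity_conformal {g ĝ : Metric M} {Υ : SmoothFun M} (h : IsConformalChange g ĝ Υ)
    (φ : OpenPartialHomeomorph M (E n)) (y : E n) :
    chartDensity ĝ φ y = Real.exp (n * Υ (φ.symm y)) * chartDensity g φ y := by
  rw [chartDensity, metricMatrix_conformal h, Matrix.det_smul, Real.sqrt_mul (by positivity),
    chartDensity, Fintype.card_fin, ← Real.exp_nat_mul, ← Real.exp_half]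
  ring_nf

lemma lintegral_chartVolume (g : Metric M) {φ : OpenPartialHomeomorph M (E n)}
    (hφ : φ ∈ smoothCharts M) {f : M → ℝ≥0∞} (hf : Measurable f) {B : Set M}
    (hB : MeasurableSet B) : ∫⁻ x in B, f x ∂(chartVolume g φ) =
      ∫⁻ y in φ.target ∩ φ.symm ⁻¹' B, ENNReal.ofReal (chartDensity g φ y) * f (φ.symm y) := by
  have hT := measurableSet_target_inter φ hB
  have hms : AEMeasurable φ.symm (volume.restrict φ.target) :=
    φ.continuousOn_symm.aemeasurable φ.open_target.measurableSet
  rw [← lintegral_indicator hB, chartVolume, lintegral_map' (hf.indicator hB).aemeasurable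
    (aemeasurable_chart_symm g φ)]
  change ∫⁻ y, (B.indicator f ∘ φ.symm) y ∂_ = _
  rw [lintegral_withDensity_eq_lintegral_mul₀
      (aemeasurable_chartDensity g hφ φ.open_target.measurableSet subset_rfl)
      ((hf.indicator hB).comp_aemeasurable hms),
    ← lintegral_indicator φ.open_target.measurableSet, ← lintegral_indicator hT]
  congr 1 with y
  by_cases hy : y ∈ φ.target <;> by_cases hB' : φ.symm y ∈ B <;>
    simp [indicator, hy, hB', Pi.mul_apply]

/-- The volume measure of a conformally related metric. -/
lemma vol_conformal {g ĝ : Metric M} {Υ : SmoothFun M} (h : IsConformalChange g ĝ Υ) :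
    vol ĝ = (vol g).withDensity fun x => ENNReal.ofReal (Real.exp (n * Υ x)) := by
  have hm : Measurable fun x : M => ENNReal.ofReal (Real.exp (n * Υ x)) :=
    (Real.continuous_exp.comp
      (continuous_const.mul Υ.contMDiff.continuous)).measurable.ennreal_ofReal
  obtain ⟨T, hTc, hT⟩ := TopologicalSpace.countable_cover_nhds fun x : M =>
    (chartAt (E n) x).open_source.mem_nhds (mem_chart_source _ x)
  refine Measure.ext_of_biUnion_eq_univ hTc hT fun x _ => Measure.ext fun B hB => ?_
  have hφ : chartAt (E n) x ∈ smoothCharts M := IsManifold.chart_mem_maximalAtlas x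
  set φ := chartAt (E n) x
  have hB' := hB.inter φ.open_source.measurableSet
  have hsub : B ∩ φ.source ⊆ φ.source := inter_subset_right
  rw [Measure.restrict_apply hB, Measure.restrict_apply hB, vol_apply_of_subset ĝ hφ hB' hsub,
    withDensity_apply _ hB']
  have hr : (vol g).restrict (B ∩ φ.source) = (chartVolume g φ).restrict (B ∩ φ.source) := by
    ext A hA
    rw [Measure.restrict_apply hA, Measure.restrict_apply hA,
      vol_apply_of_subset g hφ (hA.inter hB') (inter_subset_right.trans hsub)]
  rw [hr, lintegral_chartVolume g hφ hm hB', chartVolume_apply ĝ φ hB']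
  refine lintegral_congr fun y => ?_
  rw [chartDensity_conformal h, ENNReal.ofReal_mul (Real.exp_pos _).le, mul_comm]

lemma jacobian_conformal {g ĝ : Metric M} {Υ : SmoothFun M} (h : IsConformalChange g ĝ Υ)
    (x : M) : ConstrainedOp.jacobian g ĝ x = Real.exp (n * Υ x) := by
  have hφ : chartAt (E n) x ∈ smoothCharts M := IsManifold.chart_mem_maximalAtlas x
  rw [ConstrainedOp.jacobian, chartDensity_conformal h,
    (chartAt (E n) x).left_inv (mem_chart_source _ x), mul_div_assoc, div_self, mul_one]
  exact (chartDensity_pos g hφ ((chartAt (E n) x).map_source (mem_chart_source _ x))).ne'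

end Volume

/-! ### Naturality under local isometries -/

section Locality

variable {n : ℕ} {S : Set (E n)} {G G' : E n → Matrix (Fin n) (Fin n) ℝ}

/-- Coordinate expressions in two charts will agree only on the target of one of them. Openness of
this set lets the equality pass through all derivatives occurring in a contraction. -/
lemma pderiv_eqOn (hS : IsOpen S) {f f' : E n → ℝ} (h : EqOn f f' S) (i : Fin n) :
    EqOn (pderiv i f) (pderiv i f') S := fun y hy => by
  rw [pderiv, pderiv, (h.eventuallyEq_of_mem (hS.mem_nhds hy)).fderiv_eq]

lemma christoffel_eqOn (hS : IsOpen S) (h : EqOn G G' S) (k i j : Fin n) :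
    EqOn (christoffel G k i j) (christoffel G' k i j) S := fun y hy => by
  have hc : ∀ a b, EqOn (fun z => G z a b) (fun z => G' z a b) S := fun a b z hz => by
    simp only [h hz]
  simp only [christoffel, h hy, pderiv_eqOn hS (hc _ _) _ hy]

lemma riemann_eqOn (hS : IsOpen S) (h : EqOn G G' S) (I : Fin 4 → Fin n) :
    EqOn (riemann G I) (riemann G' I) S := fun y hy => by
  simp only [riemann, h hy, christoffel_eqOn hS h _ _ _ hy,
    pderiv_eqOn hS (christoffel_eqOn hS h _ _ _) _ hy]

lemma iterCovDeriv_eqOn (hS : IsOpen S) (h : EqOn G G' S) {p : ℕ} {T T' : CoordTensor n p}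
    (hT : ∀ I, EqOn (T I) (T' I) S) (N : ℕ) (I : Fin (p + N) → Fin n) :
    EqOn (iterCovDeriv G T N I) (iterCovDeriv G' T' N I) S := by
  induction N with
  | zero => exact hT I
  | succ N ih =>
    intro y hy
    simp only [iterCovDeriv, covDeriv]
    rw [pderiv_eqOn hS (ih _) _ hy]
    congr 1
    refine Finset.sum_congr rfl fun s _ => Finset.sum_congr rfl fun l _ => ?_
    rw [christoffel_eqOn hS h _ _ _ hy, ih _ hy]

/-- The value of a contraction depends only on the germs of the metric and the functions. -/
lemma Contraction.eval_eqOn {ℓ : ℕ} (c : Contraction ℓ) (hS : IsOpen S) (h : EqOn G G' S)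
    {f f' : Fin ℓ → E n → ℝ} (hf : ∀ b, EqOn (f b) (f' b) S) :
    EqOn (c.eval G f) (c.eval G' f') S := fun y hy => by
  simp only [Contraction.eval, h hy]
  refine Finset.sum_congr rfl fun I _ => ?_
  congr 1
  · congr 1
    refine Finset.prod_congr rfl fun a _ => ?_
    exact iterCovDeriv_eqOn hS h (riemann_eqOn hS h) _ _ hy
  · refine Finset.prod_congr rfl fun b _ => ?_
    exact iterCovDeriv_eqOn hS h (fun _ => hf b) _ _ hy

end Locality

section Naturality

variable {n : ℕ} {M N : SmoothManifold.{u} n}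

/-- The pullback `p^* v` of a smooth function. -/
def SmoothFun.pullback (p : N → M) (hp : ContMDiff (𝓡 n) (𝓡 n) ∞ p) (v : SmoothFun M) :
    SmoothFun N :=
  ⟨fun x => v (p x), v.contMDiff.comp hp⟩

@[simp] lemma SmoothFun.pullback_apply (p : N → M) (hp : ContMDiff (𝓡 n) (𝓡 n) ∞ p)
    (v : SmoothFun M) (x : N) : SmoothFun.pullback p hp v x = v (p x) := rfl

/-- Near each point, a local diffeomorphism is the identity in suitable charts. -/
lemma exists_adapted_chart {p : N → M} (hp : IsLocalDiffeomorph (𝓡 n) (𝓡 n) ∞ p) (x : N) :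
    ∃ ψ ∈ smoothCharts N, ∃ φ ∈ smoothCharts M, x ∈ ψ.source ∧ p x ∈ φ.source ∧
      MapsTo p ψ.source φ.source ∧ (∀ z ∈ ψ.source, ψ z = φ (p z)) := by
  obtain ⟨Φ, hxΦ, hΦ⟩ := hp x
  have hφ : chartAt (E n) (p x) ∈ smoothCharts M := IsManifold.chart_mem_maximalAtlas (p x)
  have hpx : p x ∈ (chartAt (E n) (p x)).source := mem_chart_source _ _
  set φ := chartAt (E n) (p x)
  set Φ' := Φ.toOpenPartialHomeomorph
  refine ⟨Φ'.trans φ, ?_, φ, hφ, ?_, hpx, ?_, ?_⟩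
  · refine OpenPartialHomeomorph.mem_maximalAtlas_of_contMDiffOn (I := 𝓡 n) (n := ∞) _ ?_ ?_
    · refine (contMDiffOn_of_mem_maximalAtlas hφ).comp
        (Φ.contMDiffOn_toFun.mono fun z hz => ?_) fun z hz => ?_
      · rw [OpenPartialHomeomorph.trans_source] at hz; exact hz.1
      · rw [OpenPartialHomeomorph.trans_source] at hz; exact hz.2
    · refine Φ.contMDiffOn_invFun.comp
        ((contMDiffOn_symm_of_mem_maximalAtlas hφ).mono fun z hz => ?_) fun z hz => ?_
      · rw [OpenPartialHomeomorph.trans_target] at hz; exact hz.1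
      · rw [OpenPartialHomeomorph.trans_target] at hz; exact hz.2
  · rw [OpenPartialHomeomorph.trans_source]
    exact ⟨hxΦ, by rw [mem_preimage, show Φ' x = p x from (hΦ hxΦ).symm]; exact hpx⟩
  · intro z hz
    rw [OpenPartialHomeomorph.trans_source] at hz
    rw [hΦ hz.1]; exact hz.2
  · intro z hz
    rw [OpenPartialHomeomorph.trans_source] at hz
    rw [hΦ hz.1]; rfl

/-- Natural operators commute with local isometries. -/
lemma PolydiffOp.toFun_pullback {ℓ : ℕ} (D : PolydiffOp.{u} n ℓ) {p : N → M}
    (hp : IsLocalDiffeomorph (𝓡 n) (𝓡 n) ∞ p) {g : Metric M} {h : Metric N}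
    (hpb : IsPullback p g h) (v : Fin ℓ → SmoothFun M) (x : N) :
    D.toFun N h (fun i => (v i).pullback p hp.contMDiff) x = D.toFun M g v (p x) := by
  obtain ⟨L, hL⟩ := D.natural
  obtain ⟨ψ, hψ, φ, hφ, hx, hpx, hmaps, hψφ⟩ := exists_adapted_chart hp x
  rw [hL N h _ ψ hψ x hx, hL M g v φ hφ (p x) hpx, ← hψφ x hx]
  have hsymm : ∀ y ∈ ψ.target, p (ψ.symm y) ∈ φ.source ∧ φ (p (ψ.symm y)) = y := fun y hy =>
    ⟨hmaps (ψ.map_target hy), by rw [← hψφ _ (ψ.map_target hy), ψ.right_inv hy]⟩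
  -- In adapted charts `p` is the identity, so its Jacobian matrix is `1` and both metrics have the
  -- same coefficients. The universal formula then gives the same value.
  have hG : EqOn (metricMatrix h ψ) (metricMatrix g φ) ψ.target := fun y hy => by
    have hder : fderiv ℝ (fun z => φ (p (ψ.symm z))) y = ContinuousLinearMap.id ℝ (E n) := by
      rw [← fderiv_id (𝕜 := ℝ) (x := y)]
      refine Filter.EventuallyEq.fderiv_eq ?_
      filter_upwards [ψ.open_target.mem_nhds hy] with z hz using (hsymm z hz).2
    have hJ : jacobianMatrix (fun z => φ (p (ψ.symm z))) y = 1 := by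
      ext i j
      simp [jacobianMatrix, hder, Matrix.one_apply]
    rw [metricMatrix_pullback hpb hφ hψ hy (hsymm y hy).1 (hp.mdifferentiable (by simp) _), hJ,
      (hsymm y hy).2]
    simp
  congr 1
  refine List.map_congr_left fun t _ => ?_
  congr 1
  refine t.2.eval_eqOn ψ.open_target hG (fun b y hy => ?_) (ψ.map_source hx)
  have : φ.symm y = p (ψ.symm y) := by
    rw [← φ.left_inv (hsymm y hy).1, (hsymm y hy).2]
  simp [this]

end Naturality

/-! ### Pullback of solutions and behavior of the critical energy -/

namespace ConstrainedOp

variable {n ℓ k : ℕ} (D : ConstrainedOp.{u} n ℓ k) {M N : SmoothManifold.{u} n}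

lemma pullback_mem_cone {p : N → M} (hp : IsLocalDiffeomorph (𝓡 n) (𝓡 n) ∞ p) {g : Metric M}
    {h : Metric N} (hpb : IsPullback p g h) {v : SmoothFun M} (hv : v ∈ D.cone g) :
    v.pullback p hp.contMDiff ∈ D.cone h := fun C hC x => by
  have := C.2.toFun_pullback hp hpb (fun _ => v) x
  rw [this]
  exact hv C hC (p x)

lemma SolvesPDE.pullback {p : N → M} (hp : IsLocalDiffeomorph (𝓡 n) (𝓡 n) ∞ p) {g : Metric M}
    {h : Metric N} (hpb : IsPullback p g h) {v : SmoothFun M} (hv : D.SolvesPDE g v) :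
    D.SolvesPDE h (v.pullback p hp.contMDiff) := fun x => by
  rw [D.op.toFun_pullback hp hpb (fun _ => v) x]
  exact hv (p x)

/-- `∫ |v|^{r^*} dvol_g`. -/
def critEnergy (g : Metric M) (v : SmoothFun M) : ℝ := ∫ x, |v x| ^ D.critExp ∂(vol g)

lemma critExp_pos (hk : 2 * k < n) : 0 < D.critExp := by
  have : (2 * k : ℝ) < n := by exact_mod_cast hk
  have h1 : 0 < (n : ℝ) - 2 * k := by linarith
  have h2 : (0 : ℝ) < n := lt_of_le_of_lt (by positivity) this
  rw [critExp]; positivity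

lemma continuous_abs_rpow (hk : 2 * k < n) (v : SmoothFun M) :
    Continuous fun x => |v x| ^ D.critExp :=
  v.contMDiff.continuous.abs.rpow_const fun _ => Or.inr (D.critExp_pos hk).le

lemma critEnergy_nonneg (g : Metric M) (v : SmoothFun M) : 0 ≤ D.critEnergy g v :=
  integral_nonneg fun x => by positivity

lemma critNorm_eq (hk : 2 * k < n) (g : Metric M) (v : SmoothFun M) :
    D.critNorm g v = D.critEnergy g v ^ (D.critExp)⁻¹ := by
  have hr := D.critExp_pos hk
  rw [critNorm, lpNorm_eq_integral_norm_rpow_toReal (by simpa using hr) ENNReal.ofReal_ne_top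
    v.contMDiff.continuous.aestronglyMeasurable, ENNReal.toReal_ofReal hr.le]
  rfl

/-- The critical energy is multiplied by the degree under a covering. -/
lemma critEnergy_pullback (hk : 2 * k < n) {p : N → M} (hp : IsLocalDiffeomorph (𝓡 n) (𝓡 n) ∞ p)
    {g : Metric M} {h : Metric N} (hpb : IsPullback p g h) {d : ℕ}
    (hfin : ∀ x, (p ⁻¹' {x}).Finite) (hd : ∀ x, (p ⁻¹' {x}).ncard = d) (v : SmoothFun M) :
    D.critEnergy h (v.pullback p hp.contMDiff) = d * D.critEnergy g v := by
  have h1 := map_vol_eq_smul hp hpb hfin hd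
  have h2 : ∫ x, |v x| ^ D.critExp ∂((vol h).map p) = ∫ x, |v (p x)| ^ D.critExp ∂(vol h) :=
    integral_map hp.contMDiff.continuous.aemeasurable
      (D.continuous_abs_rpow hk v).aestronglyMeasurable
  rw [h1, integral_smul_measure] at h2
  rw [critEnergy, critEnergy]
  simpa using h2.symm

/-- The critical energy is invariant under conformal diffeomorphisms. -/
lemma GeomEquivalent.critEnergy_eq (hk : 2 * k < n) {g : Metric M} {v₁ v₂ : SmoothFun M}
    (he : D.GeomEquivalent g v₁ v₂) : D.critEnergy g v₁ = D.critEnergy g v₂ := by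
  obtain ⟨Φ, ĝ, hpb, ⟨Υ, hΥ⟩, hv⟩ := he
  have hpre : ∀ x, Φ ⁻¹' {x} = {Φ.symm x} := fun x => by
    ext y
    simp only [mem_preimage, mem_singleton_iff]
    exact ⟨fun hy => by rw [← hy, Φ.symm_apply_apply], fun hy => by rw [hy, Φ.apply_symm_apply]⟩
  -- A diffeomorphism is a covering of degree one; it remains to pass from `ĝ` to `g`.
  have h1 := D.critEnergy_pullback (d := 1) hk Φ.isLocalDiffeomorph hpb
    (fun x => by rw [hpre]; exact finite_singleton _) (fun x => by rw [hpre]; exact ncard_singleton _)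
    v₂
  rw [Nat.cast_one, one_mul] at h1
  have hm : Measurable fun x : M => Real.exp (n * Υ x) :=
    (Real.continuous_exp.comp (continuous_const.mul Υ.contMDiff.continuous)).measurable
  rw [← h1, critEnergy, critEnergy, vol_conformal hΥ,
    integral_withDensity_eq_integral_toReal_smul hm.ennreal_ofReal
      (Filter.Eventually.of_forall fun _ => ENNReal.ofReal_lt_top)]
  refine integral_congr_ae (Filter.Eventually.of_forall fun x => ?_)
  have hn : (n : ℝ) ≠ 0 := by
    have : 0 < n := by omega
    positivity
  have hnk : (n : ℝ) - 2 * k ≠ 0 := by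
    have : (2 * k : ℝ) < n := by exact_mod_cast hk
    linarith
  -- The Jacobian exponent is the reciprocal of `r*`, so `|v₁|^{r*}` contains the Jacobian to the
  -- first power, which is the density of `dvol_ĝ` with respect to `dvol_g`.
  have hexp : (((n : ℝ) - 2 * k) / (ℓ + 1)) / n * D.critExp = 1 := by
    rw [critExp]; field_simp
  simp only [hv x, jacobian_conformal hΥ, SmoothFun.pullback_apply, smul_eq_mul]
  rw [abs_mul, abs_of_pos (Real.rpow_pos_of_pos (Real.exp_pos _) _),
    Real.mul_rpow (Real.rpow_nonneg (Real.exp_pos _).le _) (abs_nonneg _),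
    ← Real.rpow_mul (Real.exp_pos _).le, hexp, Real.rpow_one,
    ENNReal.toReal_ofReal (Real.exp_pos _).le]

end ConstrainedOp

/-! ### Energies of solutions -/

namespace ConstrainedOp

variable {n ℓ k : ℕ} (D : ConstrainedOp.{u} n ℓ k) {M : SmoothManifold.{u} n}

lemma smul_mem_cone {g : Metric M} {v : SmoothFun M} (hv : v ∈ D.cone g) {t : ℝ} (ht : 0 < t) :
    t • v ∈ D.cone g := fun C hC x => by
  have h1 : C.2.toFun M g (fun _ => t • v) = t ^ C.1 • C.2.toFun M g (fun _ => v) := by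
    rw [MultilinearMap.map_smul_univ (C.2.toFun M g) (fun _ => t) (fun _ => v)]
    simp
  rw [h1]
  exact mul_pos (pow_pos ht _) (hv C hC x)

lemma critEnergy_smul (g : Metric M) (v : SmoothFun M) {t : ℝ} (ht : 0 < t) :
    D.critEnergy g (t • v) = t ^ D.critExp * D.critEnergy g v := by
  rw [critEnergy, critEnergy, ← integral_const_mul]
  refine integral_congr_ae (Filter.Eventually.of_forall fun x => ?_)
  change |t * v x| ^ D.critExp = _
  rw [abs_mul, abs_of_pos ht, Real.mul_rpow ht.le (abs_nonneg _)]

lemma dirichlet_smul (g : Metric M) (v : SmoothFun M) (t : ℝ) :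
    D.op.dirichlet g (fun _ => t • v) = t ^ (ℓ + 1) * D.op.dirichlet g (fun _ => v) := by
  have h1 : D.op.toFun M g (fun _ => t • v) = t ^ ℓ • D.op.toFun M g (fun _ => v) := by
    rw [MultilinearMap.map_smul_univ (D.op.toFun M g) (fun _ => t) (fun _ => v)]
    simp
  rw [PolydiffOp.dirichlet, PolydiffOp.dirichlet, ← integral_const_mul]
  refine integral_congr_ae (Filter.Eventually.of_forall fun x => ?_)
  change (t * v x) * D.op.toFun M g (fun _ => t • v) x = _ * (v x * D.op.toFun M g (fun _ => v) x)
  rw [h1]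
  change (t * v x) * (t ^ ℓ * D.op.toFun M g (fun _ => v) x) = _
  ring

/-- The set where `v` is nonzero is open and nonempty, hence of positive volume; compactness
provides integrability. -/
lemma critEnergy_pos [CompactSpace M] (hk : 2 * k < n) (g : Metric M) {v : SmoothFun M}
    (hv : v ≠ 0) : 0 < D.critEnergy g v := by
  have hc := D.continuous_abs_rpow hk v
  have hx : ∃ x, v x ≠ 0 := by
    by_contra! h
    exact hv (ContMDiffMap.ext h)
  obtain ⟨x, hx⟩ := hx
  have hsupp : IsOpen {x : M | v x ≠ 0} := isOpen_ne.preimage v.contMDiff.continuous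
  rw [critEnergy, integral_pos_iff_support_of_nonneg (fun x => by positivity)
    (hc.integrable_of_hasCompactSupport (HasCompactSupport.of_compactSpace _))]
  refine (pos_iff_ne_zero.2 (vol_ne_zero_of_isOpen g hsupp ⟨x, hx⟩)).trans_le (measure_mono ?_)
  intro y hy
  exact (Real.rpow_pos_of_pos (abs_pos.2 hy) _).ne'

variable {D} in
-- Multiplying the equation by `v` adds `2` to the exponent on its right-hand side, and the sum is
-- `r*`.
lemma SolvesPDE.dirichlet_eq (hk : 2 * k < n) {g : Metric M} {v : SmoothFun M}
    (hv : D.SolvesPDE g v) : D.op.dirichlet g (fun _ => v) = D.critEnergy g v := by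
  refine integral_congr_ae (Filter.Eventually.of_forall fun x => ?_)
  change v x * D.op.toFun M g (fun _ => v) x = |v x| ^ D.critExp
  have hnk : (n : ℝ) - 2 * k ≠ 0 := by
    have : (2 * k : ℝ) < n := by exact_mod_cast hk
    linarith
  rw [hv x]
  rcases eq_or_ne (v x) 0 with h0 | h0
  · rw [h0, abs_zero, Real.zero_rpow (D.critExp_pos hk).ne']; simp
  · have hexp : D.critExp = (((ℓ : ℝ) - 1) * n + 4 * k) / ((n : ℝ) - 2 * k) + 2 := by
      rw [critExp]; field_simp; ring
    rw [hexp, Real.rpow_add (abs_pos.2 h0), Real.rpow_two, sq_abs]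
    ring

lemma critEnergy_le_of_critNorm_le (hk : 2 * k < n) {g : Metric M} {v : SmoothFun M} {Λ : ℝ}
    (h : D.critNorm g v ≤ Λ) : D.critEnergy g v ≤ Λ ^ D.critExp := by
  have hr := D.critExp_pos hk
  have h0 := D.critEnergy_nonneg g v
  rw [D.critNorm_eq hk] at h
  calc D.critEnergy g v = (D.critEnergy g v ^ (D.critExp)⁻¹) ^ D.critExp := by
        rw [← Real.rpow_mul h0, inv_mul_cancel₀ hr.ne', Real.rpow_one]
    _ ≤ _ := Real.rpow_le_rpow (Real.rpow_nonneg h0 _) h hr.le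

/-- If the Yamabe constant is positive, then the energies of solutions are bounded below. -/
lemma exists_le_critEnergy (hk : 2 * k < n) (hk0 : 0 < k) (M : CompactConformalManifold.{u} n)
    (hY : 0 < D.yamabeConstant M) : ∃ δ : ℝ, 0 < δ ∧ ∀ g ∈ M.metrics, ∀ v ∈ D.cone g, v ≠ 0 →
      D.SolvesPDE g v → δ ≤ D.critEnergy g v := by
  have := M.compact
  -- A real number below the Yamabe constant is used because the constant itself may be `⊤`.
  obtain ⟨y, hy0, hyY⟩ := EReal.lt_iff_exists_real_btwn.1 hY
  have hy0 : 0 < y := by exact_mod_cast hy0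
  have hnpos : (0 : ℝ) < n := by
    have : 0 < n := by omega
    positivity
  have hkpos : (0 : ℝ) < k := by positivity
  -- For a solution of energy `e`, the multiple of norm one has Dirichlet form `e^{1 - r/r*} =
  -- e^{2k/n}`. This is at least `y`, and `k > 0` allows solving for `e`.
  refine ⟨y ^ ((n : ℝ) / (2 * k)), Real.rpow_pos_of_pos hy0 _, fun g hg v hv hv0 hsol => ?_⟩
  have hr := D.critExp_pos hk
  have hE := D.critEnergy_pos hk g hv0
  set e := D.critEnergy g v with he
  set t : ℝ := e ^ (-(D.critExp)⁻¹) with ht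
  have ht0 : 0 < t := Real.rpow_pos_of_pos hE _
  have h1 : D.critEnergy g (t • v) = 1 := by
    rw [D.critEnergy_smul g v ht0, ← he, ht, ← Real.rpow_mul hE.le, neg_mul,
      inv_mul_cancel₀ hr.ne', Real.rpow_neg_one, inv_mul_cancel₀ hE.ne']
  have h2 : D.critNorm g (t • v) = 1 := by rw [D.critNorm_eq hk, h1, Real.one_rpow]
  have h3 : D.yamabeConstant M ≤ ((D.op.dirichlet g (fun _ => t • v) : ℝ) : EReal) :=
    iInf₂_le_of_le g hg (iInf₂_le (t • v) ⟨D.smul_mem_cone hv ht0, h2⟩)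
  have h4 : y ≤ D.op.dirichlet g (fun _ => t • v) := by
    exact_mod_cast hyY.le.trans h3
  have hnk : (n : ℝ) - 2 * k ≠ 0 := by
    have : (2 * k : ℝ) < n := by exact_mod_cast hk
    linarith
  have h5 : D.op.dirichlet g (fun _ => t • v) = e ^ ((2 * k : ℝ) / n) := by
    rw [D.dirichlet_smul, hsol.dirichlet_eq hk, ← he, ht, ← Real.rpow_natCast,
      ← Real.rpow_mul hE.le]
    nth_rewrite 2 [← Real.rpow_one e]
    rw [← Real.rpow_add hE]
    congr 1
    rw [critExp]
    push_cast
    field_simp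
    ring
  rw [h5] at h4
  calc y ^ ((n : ℝ) / (2 * k)) ≤ (e ^ ((2 * k : ℝ) / n)) ^ ((n : ℝ) / (2 * k)) :=
        Real.rpow_le_rpow hy0.le h4 (by positivity)
    _ = e := by
      rw [← Real.rpow_mul hE.le, div_mul_div_comm, mul_comm, div_self (by positivity),
        Real.rpow_one]

variable {D} in
/-- In the scale-invariant case `k = 0`, multiples of solutions are solutions. -/
lemma SolvesPDE.smul (hn : 0 < n) (hk : k = 0) {g : Metric M} {v : SmoothFun M}
    (hv : D.SolvesPDE g v) {t : ℝ} (ht : 0 < t) : D.SolvesPDE g (t • v) := fun x => by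
  have h1 : D.op.toFun M g (fun _ => t • v) = t ^ ℓ • D.op.toFun M g (fun _ => v) := by
    rw [MultilinearMap.map_smul_univ (D.op.toFun M g) (fun _ => t) (fun _ => v)]
    simp
  rw [h1]
  change t ^ ℓ * D.op.toFun M g (fun _ => v) x = |t * v x| ^ _ * (t * v x)
  rw [hv x, abs_mul, Real.mul_rpow (abs_nonneg _) (abs_nonneg _), abs_of_pos ht]
  have hn' : (n : ℝ) ≠ 0 := by positivity
  -- For `k = 0` both sides of the equation are homogeneous of degree `ℓ`. The exponent `ℓ - 1`
  -- stays real, as `ℓ` may be `0`.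
  have hexp : (((ℓ : ℝ) - 1) * n + 4 * k) / ((n : ℝ) - 2 * k) = (ℓ : ℝ) - 1 := by
    rw [hk, Nat.cast_zero, mul_zero, mul_zero, add_zero, sub_zero, mul_div_assoc, div_self hn',
      mul_one]
  have h2 : t ^ ((ℓ : ℝ) - 1) * t = t ^ ℓ := by
    rw [← Real.rpow_natCast]
    nth_rewrite 2 [← Real.rpow_one t]
    rw [← Real.rpow_add ht]; ring_nf
  rw [hexp, ← h2]
  ring

end ConstrainedOp

/-! ### The smooth structure of a covering space -/

section PulledBackCharts

variable {n : ℕ} {M : SmoothManifold.{u} n} {X : Type u} [TopologicalSpace X] {π : X → M}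

/-- The charts of `X` obtained by composing charts of `M` with a local homeomorphism `π`. -/
@[reducible]
def pulledBackCharts (hπ : IsLocalHomeomorph π) : ChartedSpace (E n) X where
  atlas := range fun x => (hπ x).choose.trans (chartAt (E n) (π x))
  chartAt x := (hπ x).choose.trans (chartAt (E n) (π x))
  mem_chart_source x := by
    rw [OpenPartialHomeomorph.trans_source]
    refine ⟨(hπ x).choose_spec.1, ?_⟩
    rw [mem_preimage, ← (hπ x).choose_spec.2]
    exact mem_chart_source _ _
  chart_mem_atlas x := ⟨x, rfl⟩

/-- The local sections of `π` cancel, so the transition maps are restrictions of transition maps of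
`M`. -/
lemma isManifold_pulledBackCharts (hπ : IsLocalHomeomorph π) :
    let _ := pulledBackCharts hπ
    IsManifold (𝓡 n) ∞ X := by
  let _ := pulledBackCharts hπ
  refine isManifold_of_contDiffOn _ _ _ ?_
  rintro _ _ ⟨x, rfl⟩ ⟨x', rfl⟩
  have hφ : chartAt (E n) (π x) ∈ smoothCharts M := IsManifold.chart_mem_maximalAtlas _
  have hφ' : chartAt (E n) (π x') ∈ smoothCharts M := IsManifold.chart_mem_maximalAtlas _
  obtain ⟨-, he⟩ := (hπ x).choose_spec
  obtain ⟨-, he'⟩ := (hπ x').choose_spec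
  set e := (hπ x).choose
  set e' := (hπ x').choose
  set φ := chartAt (E n) (π x)
  set φ' := chartAt (E n) (π x')
  have key : ContDiffOn ℝ ∞ (φ' ∘ φ.symm) (φ.target ∩ φ.symm ⁻¹' φ'.source) := by
    rw [← contMDiffOn_iff_contDiffOn]
    exact (contMDiffOn_of_mem_maximalAtlas hφ').comp
      ((contMDiffOn_symm_of_mem_maximalAtlas hφ).mono inter_subset_left) fun y hy => hy.2
  have hsrc : ∀ y ∈ ((e.trans φ).symm.trans (e'.trans φ')).source,
      y ∈ φ.target ∧ φ.symm y ∈ e.target ∧ π (e.symm (φ.symm y)) ∈ φ'.source := by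
    intro y hy
    simp only [OpenPartialHomeomorph.trans_source, OpenPartialHomeomorph.symm_source,
      OpenPartialHomeomorph.trans_target, mem_inter_iff, mem_preimage,
      OpenPartialHomeomorph.coe_trans_symm, Function.comp_apply] at hy
    exact ⟨hy.1.1, hy.1.2, by have := hy.2.2; rwa [← he'] at this⟩
  have hπe : ∀ z ∈ e.target, π (e.symm z) = z := fun z hz => by
    rw [he]; exact e.right_inv hz
  refine (key.mono ?_).congr ?_
  · rintro y ⟨hy, -⟩
    obtain ⟨h1, h2, h3⟩ := hsrc y hy
    rw [hπe _ h2] at h3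
    exact ⟨h1, h3⟩
  · rintro y ⟨hy, -⟩
    obtain ⟨h1, h2, h3⟩ := hsrc y hy
    change φ' (e' (e.symm (φ.symm y))) = φ' (φ.symm y)
    rw [← he', hπe _ h2]

/-- The covering space `X` as a smooth manifold. -/
def SmoothManifold.pullback (M : SmoothManifold.{u} n) {π : X → M} (hπ : IsLocalHomeomorph π)
    [T2Space X] [SecondCountableTopology X] : SmoothManifold.{u} n :=
  letI := pulledBackCharts hπ
  haveI := isManifold_pulledBackCharts hπ
  { carrier := X }

/-- The projection of a covering space, as a map of manifolds. -/
def SmoothManifold.pullbackProj (M : SmoothManifold.{u} n) {π : X → M} (hπ : IsLocalHomeomorph π)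
    [T2Space X] [SecondCountableTopology X] : M.pullback hπ → M := π

lemma isLocalDiffeomorph_pullbackProj (hπ : IsLocalHomeomorph π) [T2Space X]
    [SecondCountableTopology X] :
    IsLocalDiffeomorph (𝓡 n) (𝓡 n) ∞ (M.pullbackProj hπ) := by
  intro x
  have hψ : chartAt (E n) x ∈ smoothCharts (M.pullback hπ) := IsManifold.chart_mem_maximalAtlas x
  have hφ : chartAt (E n) (π x) ∈ smoothCharts M := IsManifold.chart_mem_maximalAtlas _
  have hxψ : x ∈ (chartAt (E n) (x : M.pullback hπ)).source := mem_chart_source _ _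
  have hdef : chartAt (E n) (x : M.pullback hπ) = (hπ x).choose.trans (chartAt (E n) (π x)) := rfl
  obtain ⟨-, he⟩ := (hπ x).choose_spec
  set ψ := chartAt (E n) (x : M.pullback hπ)
  set e := (hπ x).choose
  set φ := chartAt (E n) (π x)
  have hsrc : ∀ z ∈ ψ.source, π z ∈ φ.source ∧ ψ z = φ (π z) := by
    intro z hz
    rw [hdef, OpenPartialHomeomorph.trans_source] at hz
    have hπz : π z = e z := congrFun he z
    refine ⟨hπz ▸ hz.2, ?_⟩
    rw [hdef]
    exact congrArg φ hπz.symm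
  have htgt : ∀ y ∈ ψ.target, y ∈ φ.target := by
    intro y hy
    rw [hdef, OpenPartialHomeomorph.trans_target] at hy
    exact hy.1
  set F := ψ.trans φ.symm
  have hFs : F.source ⊆ ψ.source := by
    intro z hz
    rw [OpenPartialHomeomorph.trans_source] at hz; exact hz.1
  have hFt : ∀ z ∈ F.target, z ∈ φ.source ∧ φ z ∈ ψ.target := by
    intro z hz
    rw [OpenPartialHomeomorph.trans_target] at hz
    exact ⟨hz.1, hz.2⟩
  refine ⟨⟨F.toPartialEquiv, F.open_source, F.open_target, ?_, ?_⟩, ?_, ?_⟩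
  · exact (contMDiffOn_symm_of_mem_maximalAtlas hφ).comp
      ((contMDiffOn_of_mem_maximalAtlas hψ).mono hFs)
      fun z hz => htgt _ (ψ.map_source (hFs hz))
  · exact (contMDiffOn_symm_of_mem_maximalAtlas hψ).comp
      ((contMDiffOn_of_mem_maximalAtlas hφ).mono fun z hz => (hFt z hz).1)
      fun z hz => (hFt z hz).2
  · change x ∈ F.source
    rw [OpenPartialHomeomorph.trans_source]
    exact ⟨hxψ, htgt _ (ψ.map_source hxψ)⟩
  · intro z hz
    obtain ⟨h1, h2⟩ := hsrc z (hFs hz)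
    change π z = φ.symm (ψ z)
    rw [h2, φ.left_inv h1]

end PulledBackCharts

/-! ### Pullback of metrics -/

section PullbackMetric

variable {n : ℕ} {M N : SmoothManifold.{u} n}

/-- The bilinear form `p^* g`. -/
def pullbackInner (g : Metric M) (p : N → M) (x : N) :
    TangentSpace (𝓡 n) x →L[ℝ] TangentSpace (𝓡 n) x →L[ℝ] ℝ :=
  ((metricForm g (p x)).bilinearComp (dmap p x) (dmap p x) : E n →L[ℝ] E n →L[ℝ] ℝ)

open Bundle in
-- In the trivializations at `x₀` and `p x₀`, the form is `B(A ·, A ·)`, where `A` is the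
-- differential of `p` and `B` is the metric `g` along `p`, both in coordinates and both smooth at
-- `x₀`.
lemma contMDiff_pullbackInner (g : Metric M) {p : N → M} (hp : ContMDiff (𝓡 n) (𝓡 n) ∞ p) :
    ContMDiff (𝓡 n) ((𝓡 n).prod 𝓘(ℝ, E n →L[ℝ] E n →L[ℝ] ℝ)) ∞
      (fun x => TotalSpace.mk' (E n →L[ℝ] E n →L[ℝ] ℝ)
        (E := fun b : N => TangentSpace (𝓡 n) b →L[ℝ] TangentSpace (𝓡 n) b →L[ℝ] ℝ) x
        (pullbackInner g p x)) := by
  intro x₀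
  rw [contMDiffAt_hom_bundle]
  refine ⟨contMDiffAt_id, ?_⟩
  have hg := (g.contMDiff (p x₀)).comp x₀ (hp x₀)
  have hg' := ((contMDiffAt_hom_bundle _).1 hg).2
  have hA := (hp x₀).mfderiv_const (m := ∞) (by simp)
  simp only [Function.comp_apply, TotalSpace.mk'] at hg'
  let A := inTangentCoordinates (𝓡 n) (𝓡 n) id p (mfderiv (𝓡 n) (𝓡 n) p) x₀
  let B := fun x => ContinuousLinearMap.inCoordinates (E n) (fun y : M => TangentSpace (𝓡 n) y)
    (E n →L[ℝ] ℝ) (fun y : M => TangentSpace (𝓡 n) y →L[ℝ] ℝ) (p x₀) (p x) (p x₀) (p x)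
    (g.inner (p x))
  have hcomp : ContMDiffAt (𝓡 n) 𝓘(ℝ, E n →L[ℝ] E n →L[ℝ] ℝ) ∞
      (fun x => ((ContinuousLinearMap.compL ℝ (E n) (E n) ℝ).flip (A x)).comp
        ((B x).comp (A x))) x₀ :=
    ((ContinuousLinearMap.contMDiff _).contMDiffAt.comp x₀ hA).clm_comp (hg'.clm_comp hA)
  refine hcomp.congr_of_eventuallyEq ?_
  have hN := (trivializationAt (E n) (fun y : N => TangentSpace (𝓡 n) y) x₀).open_baseSet.mem_nhds
    (mem_baseSet_trivializationAt (E n) (fun y : N => TangentSpace (𝓡 n) y) x₀)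
  have hM := (hp.continuous.continuousAt (x := x₀)).preimage_mem_nhds
    ((trivializationAt (E n) (fun y : M => TangentSpace (𝓡 n) y) (p x₀)).open_baseSet.mem_nhds
    (mem_baseSet_trivializationAt (E n) (fun y : M => TangentSpace (𝓡 n) y) (p x₀)))
  filter_upwards [hN, hM] with x hx hpx
  ext v w
  rw [inCoordinates_apply_eq₂ hx hx (mem_univ _)]
  change _ = B x (A x v) (A x w)
  have hAx : ∀ v : E n, (trivializationAt (E n) (fun y : M => TangentSpace (𝓡 n) y) (p x₀)).symm
      (p x) (A x v) = mfderiv (𝓡 n) (𝓡 n) p x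
        ((trivializationAt (E n) (fun y : N => TangentSpace (𝓡 n) y) x₀).symm x v) := by
    intro v
    rw [← Trivialization.symmL_apply (R := ℝ) _ hpx, ← Trivialization.symmL_apply (R := ℝ) _ hx]
    exact Trivialization.symmL_continuousLinearMapAt (R := ℝ)
      (trivializationAt (E n) (fun y : M => TangentSpace (𝓡 n) y) (p x₀)) hpx
      (mfderiv (𝓡 n) (𝓡 n) p x
        ((trivializationAt (E n) (fun y : N => TangentSpace (𝓡 n) y) x₀).symmL ℝ x v))
  simp only [B]
  rw [inCoordinates_apply_eq₂ hpx hpx (mem_univ _), hAx, hAx]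
  rfl

/-- The pullback of a Riemannian metric under a local diffeomorphism. -/
def Metric.pullback (g : Metric M) {p : N → M} (hp : IsLocalDiffeomorph (𝓡 n) (𝓡 n) ∞ p) :
    Metric N where
  inner := pullbackInner g p
  symm x v w := g.symm (p x) _ _
  pos x v hv := by
    refine g.pos (p x) _ fun h0 => hv ?_
    have h1 := (hp.mfderivToContinuousLinearEquiv (by simp) x).injective
      (a₁ := v) (a₂ := 0)
    refine h1 ?_
    rw [map_zero]
    exact h0
  -- The unit ball of the pulled back form lies in the image of the unit ball of `g` under the
  -- inverse differential.
  isVonNBounded x := by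
    have hb := (g.isVonNBounded (p x)).image
      ((hp.mfderivToContinuousLinearEquiv (by simp) x).symm : TangentSpace (𝓡 n) (p x) →L[ℝ]
        TangentSpace (𝓡 n) x)
    refine Bornology.IsVonNBounded.subset (fun v hv => ?_) hb
    refine ⟨mfderiv (𝓡 n) (𝓡 n) p x v, hv, ?_⟩
    exact (hp.mfderivToContinuousLinearEquiv (by simp) x).symm_apply_apply v
  contMDiff := contMDiff_pullbackInner g hp.contMDiff

lemma isPullback_pullback (g : Metric M) {p : N → M} (hp : IsLocalDiffeomorph (𝓡 n) (𝓡 n) ∞ p) :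
    IsPullback p g (g.pullback hp) := fun _ _ _ => rfl

lemma metric_ext {g h : Metric M} (hgh : ∀ x (v w : E n), metricForm g x v w = metricForm h x v w) :
    g = h := by
  have : g.inner = h.inner := by
    funext x
    exact ContinuousLinearMap.ext fun v => ContinuousLinearMap.ext fun w => hgh x v w
  cases g; cases h
  cases this
  rfl

lemma IsPullback.unique {p : N → M} {g : Metric M} {h h' : Metric N} (hh : IsPullback p g h)
    (hh' : IsPullback p g h') : h = h' :=
  metric_ext fun x v w => (hh x v w).trans (hh' x v w).symm

/-- Pullbacks along a factorization. -/
lemma IsPullback.of_comp {L : SmoothManifold.{u} n} {π : N → M} {q : L → N} {p : L → M}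
    (hπ : MDifferentiable (𝓡 n) (𝓡 n) π) (hq : MDifferentiable (𝓡 n) (𝓡 n) q)
    (hp : ∀ x, π (q x) = p x) {g : Metric M} {h : Metric N} {h' : Metric L}
    (hh : IsPullback π g h) (hh' : IsPullback p g h') : IsPullback q h h' := by
  have hpq : p = π ∘ q := funext fun x => (hp x).symm
  subst hpq
  refine isPullback_iff.2 fun x v w => ?_
  rw [isPullback_iff.1 hh', isPullback_iff.1 hh, dmap_comp (hπ _) (hq _)]
  rfl

lemma IsConformal.pullback {p : N → M} (hp : ContMDiff (𝓡 n) (𝓡 n) ∞ p) {g ĝ : Metric M}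
    {h ĥ : Metric N} (hg : IsPullback p g h) (hĝ : IsPullback p ĝ ĥ) (hc : IsConformal g ĝ) :
    IsConformal h ĥ := by
  obtain ⟨Υ, hΥ⟩ := hc
  refine ⟨Υ.pullback p hp, fun x v w => ?_⟩
  rw [hĝ x v w, hg x v w]
  exact hΥ _ _ _

end PullbackMetric

/-- A continuous lift of a local diffeomorphism through a local diffeomorphism is a local
diffeomorphism. -/
lemma IsLocalDiffeomorph.lift {n : ℕ} {M N L : SmoothManifold.{u} n} {π : N → M} {q : L → N}
    {p : L → M} (hπ : IsLocalDiffeomorph (𝓡 n) (𝓡 n) ∞ π)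
    (hp : IsLocalDiffeomorph (𝓡 n) (𝓡 n) ∞ p) (hq : Continuous q) (hpq : ∀ x, π (q x) = p x) :
    IsLocalDiffeomorph (𝓡 n) (𝓡 n) ∞ q := by
  intro x
  obtain ⟨Φ, hΦx, hΦ⟩ := hπ (q x)
  obtain ⟨Ψ, hΨx, hΨ⟩ := hp x
  let Φ' := Φ.toOpenPartialHomeomorph
  let Ψ' := (Ψ.toOpenPartialHomeomorph).restrOpen (q ⁻¹' Φ.source) (Φ.open_source.preimage hq)
  -- Near `x`, the lift must be `Φ⁻¹ ∘ Ψ`; the source is restricted to the points that `q` maps into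
  -- the sheet of `Φ`.
  let F := Ψ'.trans Φ'.symm
  have hΨs : Ψ'.source = Ψ.source ∩ q ⁻¹' Φ.source := rfl
  have hF : ∀ z ∈ F.source, z ∈ Ψ.source ∧ q z ∈ Φ.source ∧ Ψ z ∈ Φ.target := by
    intro z hz
    rw [OpenPartialHomeomorph.trans_source, hΨs] at hz
    exact ⟨hz.1.1, hz.1.2, hz.2⟩
  have hFt : ∀ z ∈ F.target, z ∈ Φ.source ∧ Φ z ∈ Ψ.target := by
    intro z hz
    rw [OpenPartialHomeomorph.trans_target] at hz
    exact ⟨hz.1, hz.2.1⟩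
  have hFq : ∀ z ∈ Ψ.source ∩ q ⁻¹' Φ.source, Ψ z = Φ (q z) := fun z hz =>
    (hΨ hz.1).symm.trans ((hpq z).symm.trans (hΦ hz.2))
  refine ⟨⟨F.toPartialEquiv, F.open_source, F.open_target, ?_, ?_⟩, ?_, ?_⟩
  · exact Φ.contMDiffOn_invFun.comp (Ψ.contMDiffOn_toFun.mono fun z hz => (hF z hz).1)
      fun z hz => (hF z hz).2.2
  · exact Ψ.contMDiffOn_invFun.comp (Φ.contMDiffOn_toFun.mono fun z hz => (hFt z hz).1)
      fun z hz => (hFt z hz).2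
  · change x ∈ F.source
    rw [OpenPartialHomeomorph.trans_source, hΨs]
    refine ⟨⟨hΨx, hΦx⟩, ?_⟩
    change Ψ x ∈ Φ.target
    rw [hFq x ⟨hΨx, hΦx⟩]
    exact Φ.map_source hΦx
  · intro z hz
    obtain ⟨h1, h2, h3⟩ := hF z hz
    change q z = Φ.invFun (Ψ z)
    rw [hFq z ⟨h1, h2⟩]
    exact (Φ.left_inv h2).symm

/-! ### Coverings of conformal manifolds -/

section Covering

variable {n : ℕ} (M : CompactConformalManifold.{u} n) {X : Type u} [TopologicalSpace X]

/-- A compact connected covering space of a conformal manifold is a conformal manifold. -/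
lemma exists_isFiniteCovering [CompactSpace X] [ConnectedSpace X] {π : X → M.toSmoothManifold}
    (hπ : IsCoveringMap π) (hfin : ∀ x, (π ⁻¹' {x}).Finite) :
    ∃ (N : CompactConformalManifold.{u} n) (e : N.toSmoothManifold ≃ₜ X),
      IsFiniteCovering N M (π ∘ e) := by
  have hloc := hπ.isLocalHomeomorph
  -- Points of one fiber are separated by the covering property, points of different fibers by open
  -- sets of the base.
  have hT2 : T2Space X := by
    refine ⟨fun x y hxy => ?_⟩
    by_cases h : π x = π y
    · exact hπ.isSeparatedMap x y h hxy
    · obtain ⟨U, V, hU, hV, hxU, hyV, hUV⟩ := t2_separation h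
      exact ⟨π ⁻¹' U, π ⁻¹' V, hU.preimage hπ.continuous, hV.preimage hπ.continuous, hxU, hyV,
        hUV.preimage π⟩
  have hsc : SecondCountableTopology X := by
    let _ := pulledBackCharts hloc
    exact ChartedSpace.secondCountable_of_sigmaCompact (E n) X
  obtain ⟨g₀, hg₀⟩ := M.isConformalClass
  have hdiff := isLocalDiffeomorph_pullbackProj hloc
  let N : CompactConformalManifold.{u} n :=
    { toSmoothManifold := M.pullback hloc
      compact := inferInstanceAs (CompactSpace X)
      connected := inferInstanceAs (ConnectedSpace X)
      metrics := {h | IsConformal (g₀.pullback hdiff) h}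
      isConformalClass := ⟨_, rfl⟩ }
  refine ⟨N, Homeomorph.refl X, hπ, hfin, hdiff, fun g hg => ⟨g.pullback hdiff, ?_,
    isPullback_pullback g hdiff⟩⟩
  rw [hg₀] at hg
  exact IsConformal.pullback hdiff.contMDiff (isPullback_pullback g₀ hdiff)
    (isPullback_pullback g hdiff) hg

end Covering

/-! ### Covering spaces from quotients of the fundamental group -/

section Holonomy

variable {X : Type u} [TopologicalSpace X] {x₀ : X} {Q : Type u} [Group Q]

/-- The image in `Q` of the loop `a b⁻¹`. -/
def holonomy (ρ : FundamentalGroup X x₀ →* Q) {x : X} (a b : Path.Homotopic.Quotient x₀ x) : Q :=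
  ρ (FundamentalGroup.fromPath (a.trans b.symm))

lemma holonomy_self (ρ : FundamentalGroup X x₀ →* Q) {x : X} (a : Path.Homotopic.Quotient x₀ x) :
    holonomy ρ a a = 1 := by
  rw [holonomy, Path.Homotopic.Quotient.trans_symm]
  exact map_one ρ

/-- The cocycle identity for the coordinate changes of `core`. The product of `FundamentalGroup`
traverses its right factor first, whence the order. -/
lemma holonomy_mul (ρ : FundamentalGroup X x₀ →* Q) {x : X}
    (a b c : Path.Homotopic.Quotient x₀ x) :
    holonomy ρ b c * holonomy ρ a b = holonomy ρ a c := by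
  rw [holonomy, holonomy, ← map_mul]
  congr 1
  change (a.trans b.symm).trans (b.trans c.symm) = a.trans c.symm
  rw [Path.Homotopic.Quotient.trans_assoc, ← Path.Homotopic.Quotient.trans_assoc b.symm,
    Path.Homotopic.Quotient.symm_trans, Path.Homotopic.Quotient.refl_trans]

lemma pathQuotient_symm_eq {x y : X} {a : Path.Homotopic.Quotient x y}
    {b : Path.Homotopic.Quotient y x} (h : a.trans b = .refl x) : a.symm = b := by
  rw [← Path.Homotopic.Quotient.trans_refl a.symm, ← h, ← Path.Homotopic.Quotient.trans_assoc,
    Path.Homotopic.Quotient.symm_trans, Path.Homotopic.Quotient.refl_trans]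

/-- A common tail cancels in the loop; this is what makes holonomies locally constant. -/
lemma holonomy_trans (ρ : FundamentalGroup X x₀ →* Q) {x y : X}
    (a b : Path.Homotopic.Quotient x₀ x) (c : Path.Homotopic.Quotient x y) :
    holonomy ρ (a.trans c) (b.trans c) = holonomy ρ a b := by
  have h : (b.trans c).symm = c.symm.trans b.symm := by
    apply pathQuotient_symm_eq
    rw [Path.Homotopic.Quotient.trans_assoc, ← Path.Homotopic.Quotient.trans_assoc c,
      Path.Homotopic.Quotient.trans_symm, Path.Homotopic.Quotient.refl_trans,
      Path.Homotopic.Quotient.trans_symm]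
  rw [holonomy, h, holonomy, Path.Homotopic.Quotient.trans_assoc,
    ← Path.Homotopic.Quotient.trans_assoc c, Path.Homotopic.Quotient.trans_symm,
    Path.Homotopic.Quotient.refl_trans]

lemma exists_holonomy_eq {ρ : FundamentalGroup X x₀ →* Q} (hρ : Function.Surjective ρ) {x : X}
    (b : Path.Homotopic.Quotient x₀ x) (q : Q) : ∃ a, holonomy ρ a b = q := by
  obtain ⟨l, hl⟩ := hρ q
  refine ⟨Path.Homotopic.Quotient.trans (FundamentalGroup.toPath l) b, ?_⟩
  rw [holonomy, Path.Homotopic.Quotient.trans_assoc, Path.Homotopic.Quotient.trans_symm,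
    Path.Homotopic.Quotient.trans_refl]
  exact hl

end Holonomy

instance : SimplyConnectedSpace unitInterval :=
  have := (convex_Icc (0 : ℝ) 1).contractibleSpace ⟨0, by simp⟩
  inferInstanceAs (SimplyConnectedSpace (Icc (0 : ℝ) 1))

instance : LocallyPathConnectedSpace unitInterval :=
  (convex_Icc (0 : ℝ) 1).locallyPathConnectedSpace

/-- The class of the initial segment of a path. -/
def initialSegment {X : Type u} [TopologicalSpace X] (γ : C(unitInterval, X)) (t : unitInterval) :
    Path.Homotopic.Quotient (γ 0) (γ t) :=
  .mk ((PathConnectedSpace.somePath 0 t).map γ.continuous)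

lemma initialSegment_trans {X : Type u} [TopologicalSpace X] (γ : C(unitInterval, X))
    {s t : unitInterval} (p : Path s t) :
    (initialSegment γ s).trans (.mk (p.map γ.continuous)) = initialSegment γ t := by
  rw [initialSegment, initialSegment, ← Path.Homotopic.Quotient.mk_trans, ← Path.map_trans,
    Path.Homotopic.Quotient.eq]
  exact (SimplyConnectedSpace.paths_homotopic _ _).map γ

/-- A choice of neighborhoods within which paths with common endpoints are homotopic. -/
structure SimpleNeighborhoods (X : Type u) [TopologicalSpace X] where
  nhd : X → Set X
  isOpen_nhd : ∀ i, IsOpen (nhd i)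
  mem_nhd : ∀ i, i ∈ nhd i
  joined : ∀ i, ∀ x ∈ nhd i, ∃ p : Path i x, range p ⊆ nhd i
  homotopic : ∀ i x y (p q : Path x y), range p ⊆ nhd i → range q ⊆ nhd i → p.Homotopic q

namespace SimpleNeighborhoods

section Sec

variable {X : Type u} [TopologicalSpace X] [PathConnectedSpace X] (S : SimpleNeighborhoods X)
  {x₀ : X}

open Classical in
/-- The homotopy class of a path from `x₀` to `x` which passes through `i` and then stays in the
neighborhood of `i`. -/
def sec (x₀ i x : X) : Path.Homotopic.Quotient x₀ x :=
  if h : x ∈ S.nhd i then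
    .mk ((PathConnectedSpace.somePath x₀ i).trans (S.joined i x h).choose)
  -- A junk value: only points of the neighborhood of `i` matter.
  else .mk (PathConnectedSpace.somePath x₀ x)

/-- Both final segments run from `i` to `y` inside the neighborhood of `i`, so they are homotopic.
-/
lemma sec_trans {i x y : X} (p : Path x y) (hp : range p ⊆ S.nhd i) :
    (S.sec x₀ i x).trans (.mk p) = S.sec x₀ i y := by
  have hx : x ∈ S.nhd i := hp ⟨0, p.source⟩
  have hy : y ∈ S.nhd i := hp ⟨1, p.target⟩
  rw [sec, sec, dif_pos hx, dif_pos hy, Path.Homotopic.Quotient.mk_trans,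
    Path.Homotopic.Quotient.mk_trans, Path.Homotopic.Quotient.trans_assoc]
  congr 1
  rw [← Path.Homotopic.Quotient.mk_trans, Path.Homotopic.Quotient.eq]
  refine S.homotopic i _ _ _ _ ?_ (S.joined i y hy).choose_spec
  rw [Path.trans_range]
  exact union_subset (S.joined i x hx).choose_spec hp

/-- A short path from `x` to `y` inside both neighborhoods extends both sections, and as a common
tail it does not change the holonomy. -/
lemma holonomy_sec_eventuallyEq [LocallyPathConnectedSpace X] {Q : Type u} [Group Q]
    (ρ : FundamentalGroup X x₀ →* Q) {i j x : X} (hi : x ∈ S.nhd i) (hj : x ∈ S.nhd j) :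
    ∀ᶠ y in 𝓝 x, holonomy ρ (S.sec x₀ i y) (S.sec x₀ j y) =
      holonomy ρ (S.sec x₀ i x) (S.sec x₀ j x) := by
  have hU : S.nhd i ∩ S.nhd j ∈ 𝓝 x :=
    ((S.isOpen_nhd i).inter (S.isOpen_nhd j)).mem_nhds ⟨hi, hj⟩
  obtain ⟨V, ⟨hV, hVc⟩, hVU⟩ := (LocallyPathConnectedSpace.path_connected_basis x).mem_iff.1 hU
  filter_upwards [hV] with y hy
  have hJ := hVc.joinedIn x (mem_of_mem_nhds hV) y hy
  have hr : range hJ.somePath ⊆ S.nhd i ∩ S.nhd j := by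
    rintro _ ⟨t, rfl⟩
    exact hVU (hJ.somePath_mem t)
  rw [← S.sec_trans hJ.somePath (hr.trans inter_subset_left),
    ← S.sec_trans hJ.somePath (hr.trans inter_subset_right), holonomy_trans]

end Sec

/-! ### The covering space as a bundle with discrete fiber -/

section Core

variable {X : Type u} [TopologicalSpace X] [PathConnectedSpace X] [LocallyPathConnectedSpace X]
  (S : SimpleNeighborhoods X) {x₀ : X} {Q Q' : Type u} [Group Q] [Group Q']
  [TopologicalSpace Q] [DiscreteTopology Q] [TopologicalSpace Q'] [DiscreteTopology Q']

/-- The principal bundle with fiber `Q` and holonomy `ρ`. -/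
def core (ρ : FundamentalGroup X x₀ →* Q) : FiberBundleCore X X Q where
  baseSet := S.nhd
  isOpen_baseSet := S.isOpen_nhd
  indexAt x := x
  mem_baseSet_at := S.mem_nhd
  coordChange i j x q := holonomy ρ (S.sec x₀ i x) (S.sec x₀ j x) * q
  coordChange_self i x _ v := by rw [holonomy_self, one_mul]
  continuousOn_coordChange i j := by
    rintro ⟨x, q⟩ ⟨⟨hi, hj⟩, -⟩
    refine ContinuousAt.continuousWithinAt ?_
    have h := ((continuous_fst (X := X) (Y := Q)).tendsto (x, q)).eventually
      (S.holonomy_sec_eventuallyEq ρ hi hj)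
    have h2 : ContinuousAt (fun p : X × Q => holonomy ρ (S.sec x₀ i x) (S.sec x₀ j x) * p.2)
        (x, q) :=
      (continuous_of_discreteTopology (f := fun q' : Q =>
        holonomy ρ (S.sec x₀ i x) (S.sec x₀ j x) * q')).continuousAt.comp continuousAt_snd
    refine h2.congr ?_
    filter_upwards [h] with p hp
    exact congrArg (· * p.2) hp.symm
  coordChange_comp i j k x _ v := by rw [← mul_assoc, holonomy_mul]

variable (ρ : FundamentalGroup X x₀ →* Q)

/-- The covering space with fiber `Q` and holonomy `ρ`. -/
abbrev Cover : Type u := (S.core ρ).TotalSpace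

lemma trivializationAt_snd (x : X) (e : S.Cover ρ) :
    (trivializationAt Q (S.core ρ).Fiber x e).2 =
      @HMul.hMul Q Q Q _ (holonomy ρ (S.sec x₀ e.1 e.1) (S.sec x₀ x e.1)) e.2 := rfl

/-- The projection of the covering space. -/
def proj : S.Cover ρ → X := Bundle.TotalSpace.proj

lemma isCoveringMap_proj : IsCoveringMap (S.proj ρ) := by
  have : ∀ x, DiscreteTopology ((S.core ρ).Fiber x) := fun _ => inferInstanceAs (DiscreteTopology Q)
  exact FiberBundle.isCoveringMap (F := Q) (E := (S.core ρ).Fiber)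

lemma preimage_proj_singleton (x : X) : S.proj ρ ⁻¹' {x} = range fun q : Q => (⟨x, q⟩ : S.Cover ρ) := by
  ext ⟨y, q⟩
  constructor
  · rintro rfl
    exact ⟨q, rfl⟩
  · rintro ⟨q', h⟩
    exact (congrArg Bundle.TotalSpace.proj h).symm

/-- The fiberwise map of covering spaces induced by a map of fibers. -/
def fiberMap {ρ : FundamentalGroup X x₀ →* Q} {ρ' : FundamentalGroup X x₀ →* Q'} (f : Q → Q')
    (e : S.Cover ρ) : S.Cover ρ' := ⟨e.1, f e.2⟩

/-- Both bundles are glued along the same loops, so by equivariance the map is `f` in every local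
trivialization. -/
lemma continuous_fiberMap {ρ : FundamentalGroup X x₀ →* Q} {ρ' : FundamentalGroup X x₀ →* Q'}
    {f : Q → Q'} (hf : ∀ (l : FundamentalGroup X x₀) q, f (ρ l * q) = ρ' l * f q) :
    Continuous (S.fiberMap f : S.Cover ρ → S.Cover ρ') := by
  refine continuous_iff_continuousAt.2 fun e => ?_
  have hid := (FiberBundle.continuousAt_totalSpace Q (E := (S.core ρ).Fiber)
    (fun e' : S.Cover ρ => e') (x₀ := e)).1 continuousAt_id
  refine (FiberBundle.continuousAt_totalSpace Q' (E := (S.core ρ').Fiber) _).2 ⟨hid.1, ?_⟩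
  have h2 := (continuous_of_discreteTopology (f := f)).continuousAt.comp hid.2
  refine h2.congr (Filter.Eventually.of_forall fun e' => ?_)
  exact hf _ _

/-- The fiber of an induced map of covering spaces. -/
lemma preimage_fiberMap_singleton {ρ : FundamentalGroup X x₀ →* Q}
    {ρ' : FundamentalGroup X x₀ →* Q'} (f : Q → Q') (e : S.Cover ρ') :
    (S.fiberMap f : S.Cover ρ → S.Cover ρ') ⁻¹' {e} =
      (fun q : Q => (⟨e.1, q⟩ : S.Cover ρ)) '' (f ⁻¹' {e.2}) := by
  obtain ⟨x, q'⟩ := e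
  ext ⟨y, q⟩
  constructor
  · intro h
    obtain rfl : y = x := congrArg Bundle.TotalSpace.proj h
    refine ⟨q, ?_, rfl⟩
    exact Bundle.TotalSpace.mk_inj.1 h
  · rintro ⟨q₁, hq₁, h⟩
    obtain rfl : x = y := congrArg Bundle.TotalSpace.proj h
    obtain rfl : q₁ = q := Bundle.TotalSpace.mk_inj.1 h
    exact Bundle.TotalSpace.mk_inj.2 hq₁

/-- The endpoint of the lift of a path, starting at the base point. -/
def endpoint {x : X} (c : Path.Homotopic.Quotient x₀ x) : S.Cover ρ :=
  ⟨x, (holonomy ρ c (S.sec x₀ x x) : Q)⟩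

/-- In the trivialization at `γ t₀`, the fiber coordinate is the holonomy of the initial segment
against the section there. Near `t₀` this changes only by a common tail, hence is constant. -/
lemma continuous_endpoint_initialSegment (γ : C(unitInterval, X))
    (ρ : FundamentalGroup X (γ 0) →* Q) :
    Continuous fun t => S.endpoint ρ (initialSegment γ t) := by
  refine continuous_iff_continuousAt.2 fun t₀ => ?_
  refine (FiberBundle.continuousAt_totalSpace Q (E := (S.core ρ).Fiber) _).2
    ⟨γ.continuous.continuousAt, ?_⟩
  have hU : γ ⁻¹' S.nhd (γ t₀) ∈ 𝓝 t₀ :=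
    γ.continuous.continuousAt.preimage_mem_nhds
      ((S.isOpen_nhd (γ t₀)).mem_nhds (S.mem_nhd (γ t₀)))
  obtain ⟨V, ⟨hV, hVc⟩, hVU⟩ :=
    (LocallyPathConnectedSpace.path_connected_basis t₀).mem_iff.1 hU
  have hev : ∀ t ∈ V, ((trivializationAt Q (S.core ρ).Fiber (γ t₀)
      (S.endpoint ρ (initialSegment γ t))).2 : Q) =
      holonomy ρ (initialSegment γ t₀) (S.sec (γ 0) (γ t₀) (γ t₀)) := by
    intro t ht
    have hJ := hVc.joinedIn t₀ (mem_of_mem_nhds hV) t ht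
    rw [trivializationAt_snd]
    simp only [endpoint]
    rw [holonomy_mul, ← initialSegment_trans γ hJ.somePath,
      ← S.sec_trans (hJ.somePath.map γ.continuous), holonomy_trans]
    rintro _ ⟨s, rfl⟩
    exact hVU (hJ.somePath_mem s)
  refine (continuousAt_const (y := holonomy ρ (initialSegment γ t₀)
    (S.sec (γ 0) (γ t₀) (γ t₀)))).congr ?_
  filter_upwards [hV] with t ht using (hev t ht).symm

lemma joined_endpoint_aux (γ : C(unitInterval, X)) {a b : X} (ha : γ 0 = a) (hb : γ 1 = b)
    (ρ : FundamentalGroup X a →* Q) :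
    Joined (S.endpoint ρ (.refl a)) (S.endpoint ρ (.mk ⟨γ, ha, hb⟩)) := by
  -- The endpoints are variables up to here so that they can be replaced by `γ 0` and `γ 1`, on
  -- which the types of the homotopy classes depend.
  subst ha hb
  have h0 : initialSegment γ 0 = .refl (γ 0) := by
    rw [initialSegment, ← Path.Homotopic.Quotient.mk_refl, Path.Homotopic.Quotient.eq]
    exact (SimplyConnectedSpace.paths_homotopic _ (Path.refl 0)).map γ
  let δ : Path (0 : unitInterval) 1 := ⟨⟨id, continuous_id⟩, rfl, rfl⟩
  have h1 : initialSegment γ 1 = .mk ⟨γ, rfl, rfl⟩ := by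
    rw [initialSegment, Path.Homotopic.Quotient.eq]
    exact (SimplyConnectedSpace.paths_homotopic _ δ).map γ
  rw [← h0, ← h1]
  exact ⟨⟨⟨_, S.continuous_endpoint_initialSegment γ ρ⟩, rfl, rfl⟩⟩

lemma joined_endpoint {x : X} (c : Path.Homotopic.Quotient x₀ x) :
    Joined (S.endpoint ρ (.refl x₀)) (S.endpoint ρ c) := by
  obtain ⟨p, rfl⟩ := Path.Homotopic.Quotient.mk_surjective c
  exact S.joined_endpoint_aux p.toContinuousMap p.source p.target ρ

/-- By surjectivity of `ρ`, every point of the fiber over `x` is the endpoint of a lift of some path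
from `x₀` to `x`. -/
lemma pathConnectedSpace_cover {ρ : FundamentalGroup X x₀ →* Q} (hρ : Function.Surjective ρ) :
    PathConnectedSpace (S.Cover ρ) := by
  have h : ∀ e : S.Cover ρ, Joined (S.endpoint ρ (.refl x₀)) e := by
    rintro ⟨x, q⟩
    obtain ⟨c, hc⟩ := exists_holonomy_eq hρ (S.sec x₀ x x) q
    have h' : S.endpoint ρ c = ⟨x, q⟩ := Bundle.TotalSpace.mk_inj.2 hc
    exact h' ▸ S.joined_endpoint ρ c
  exact ⟨⟨S.endpoint ρ (.refl x₀)⟩, fun e e' => (h e).symm.trans (h e')⟩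

/-- Over a compact neighborhood `K` inside a base set, the cover is a closed subset of the
trivialized compact set `K × Q`; finitely many such `K` cover `X`. -/
lemma compactSpace_cover [T2Space X] [CompactSpace X] [Finite Q] :
    CompactSpace (S.Cover ρ) := by
  have h : ∀ x : X, ∃ K ∈ 𝓝 x, IsCompact (S.proj ρ ⁻¹' K) := by
    intro x
    obtain ⟨K, hKx, hKU, hK⟩ := local_compact_nhds ((S.isOpen_nhd x).mem_nhds (S.mem_nhd x))
    refine ⟨K, hKx, ?_⟩
    have hc := (hK.prod (isCompact_univ (X := Q))).image_of_continuousOn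
      (((S.core ρ).localTriv x).continuousOn_invFun.mono
        (by rintro ⟨y, q⟩ ⟨hy, -⟩; exact ⟨hKU hy, mem_univ _⟩))
    refine hc.of_isClosed_subset ?_ ?_
    · exact hK.isClosed.preimage (S.isCoveringMap_proj ρ).continuous
    · intro e he
      refine ⟨(S.core ρ).localTriv x e, ⟨he, mem_univ _⟩, ?_⟩
      exact ((S.core ρ).localTriv x).left_inv' (hKU he)
  choose K hKx hK using h
  obtain ⟨t, ht⟩ := finite_cover_nhds hKx
  refine ⟨?_⟩
  have := t.isCompact_biUnion (f := fun x => S.proj ρ ⁻¹' K x) fun x _ => hK x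
  convert this
  rw [← preimage_iUnion₂, ht, preimage_univ]

/-- Deck transformations act transitively on the fibers. -/
lemma isRegularCovering_proj : IsRegularCovering (S.proj ρ) := by
  suffices H : ∀ (x : X) (q q' : Q), ∃ Φ : S.Cover ρ ≃ₜ S.Cover ρ,
      (∀ z, S.proj ρ (Φ z) = S.proj ρ z) ∧ Φ ⟨x, q⟩ = ⟨x, q'⟩ by
    rintro ⟨x, q⟩ ⟨y, q'⟩ h
    obtain rfl : x = y := h
    exact H x q q'
  intro x q q'
  -- Right multiplications commute with the left multiplications that glue the bundle. The element
  -- `a = q⁻¹ * q'` moves `q` to `q'`.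
  let f (a : Q) : S.Cover ρ → S.Cover ρ := S.fiberMap fun q => q * a
  have hf (a : Q) : Continuous (f a) := S.continuous_fiberMap fun l q => mul_assoc _ _ _
  have hff (a b : Q) (hab : a * b = 1) (e : S.Cover ρ) : f b (f a e) = e := by
    have key (r : Q) : r * a * b = r := by rw [mul_assoc, hab, mul_one]
    exact Bundle.TotalSpace.mk_inj.2 (key e.2)
  refine ⟨⟨⟨f (q⁻¹ * q'), f (q⁻¹ * q')⁻¹, hff _ _ (mul_inv_cancel _), hff _ _ (inv_mul_cancel _)⟩,
    hf _, hf _⟩, fun z => rfl, ?_⟩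
  exact Bundle.TotalSpace.mk_inj.2 (mul_inv_cancel_left q q')

end Core

end SimpleNeighborhoods

/-! ### Simple neighborhoods in manifolds -/

lemma exists_isOpen_simplyConnectedSpace {n : ℕ} {M : Type u} [TopologicalSpace M]
    [ChartedSpace (E n) M] (x : M) : ∃ U : Set M, IsOpen U ∧ x ∈ U ∧ SimplyConnectedSpace U := by
  let φ := chartAt (E n) x
  obtain ⟨r, hr, hball⟩ := Metric.isOpen_iff.1 φ.open_target (φ x) (mem_chart_target (E n) x)
  let ψ := φ.symm.restrOpen (Metric.ball (φ x) r) Metric.isOpen_ball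
  have hs : ψ.source = Metric.ball (φ x) r := inter_eq_right.2 hball
  have hx : φ x ∈ ψ.source := hs ▸ Metric.mem_ball_self hr
  have hψ : ψ (φ x) = x := φ.left_inv (mem_chart_source (E n) x)
  refine ⟨ψ.target, ψ.open_target, hψ ▸ ψ.map_source hx, ?_⟩
  have : ContractibleSpace ψ.source :=
    Convex.contractibleSpace (by rw [hs]; exact convex_ball _ _) ⟨_, hx⟩
  exact ψ.toHomeomorphSourceTarget.symm.toHomotopyEquiv.simplyConnectedSpace

/-- A path with range in a subset, as a path in the subset. -/
def pathCodRestrict {X : Type u} [TopologicalSpace X] {U : Set X} {x y : X} (p : Path x y)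
    (hp : range p ⊆ U) :
    Path (⟨x, hp ⟨0, p.source⟩⟩ : U) ⟨y, hp ⟨1, p.target⟩⟩ where
  toFun t := ⟨p t, hp ⟨t, rfl⟩⟩
  continuous_toFun := p.continuous.subtype_mk _
  source' := Subtype.ext p.source
  target' := Subtype.ext p.target

lemma nonempty_simpleNeighborhoods {n : ℕ} (M : Type u) [TopologicalSpace M]
    [ChartedSpace (E n) M] : Nonempty (SimpleNeighborhoods M) := by
  choose U hU hxU hsc using exists_isOpen_simplyConnectedSpace (n := n) (M := M)
  refine ⟨⟨U, hU, hxU, fun i x hx => ?_, fun i x y p q hp hq => ?_⟩⟩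
  · have := hsc i
    refine ⟨(PathConnectedSpace.somePath (⟨i, hxU i⟩ : U i) ⟨x, hx⟩).map continuous_subtype_val, ?_⟩
    rintro _ ⟨t, rfl⟩
    exact Subtype.prop _
  · have := hsc i
    exact (SimplyConnectedSpace.paths_homotopic (pathCodRestrict p hp)
      (pathCodRestrict q hq)).map ⟨_, continuous_subtype_val⟩

/-! ### Finite-index subgroups and the tower of coverings -/

open ProfiniteGrp ProfiniteCompletion in
/-- If the profinite completion is infinite, then every normal subgroup of finite index contains
normal subgroups of arbitrarily large finite index. -/
lemma exists_le_index_lt {G : Type u} [Group G] (hG : Infinite (completion (GrpCat.of G)))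
    (H : FiniteIndexNormalSubgroup G) (B : ℕ) :
    ∃ K ≤ H, B < K.toSubgroup.index := by
  by_contra! hcon
  obtain ⟨K, hKH, hK⟩ : ∃ K ≤ H, ∀ L ≤ H, L.toSubgroup.index ≤ K.toSubgroup.index := by
    have hbdd : BddAbove ((fun L : FiniteIndexNormalSubgroup G => L.toSubgroup.index) '' Iic H) :=
      ⟨B, by rintro _ ⟨L, hL, rfl⟩; exact hcon L hL⟩
    obtain ⟨K, hK, hKs⟩ := Nat.sSup_mem ⟨_, mem_image_of_mem _ self_mem_Iic⟩ hbdd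
    exact ⟨K, hK, fun L hL => (le_csSup hbdd (mem_image_of_mem _ hL)).trans hKs.ge⟩
  -- With indices below `H` bounded, a subgroup `K` of maximal index has no proper finite-index
  -- normal subgroup of `G` below it. So `K ⊓ L = K` for every `L`, which makes `K` the least one,
  -- and a compatible family is determined by its component in the finite group `G ⧸ K`.
  have hmin : ∀ L ≤ K, L = K := by
    intro L hL
    refine FiniteIndexNormalSubgroup.toSubgroup_injective (eq_of_le_of_not_lt hL fun h => ?_)
    exact (Subgroup.index_strictAnti h).not_ge (hK L (hL.trans hKH))
  let f (c : completion (GrpCat.of G)) : G ⧸ K.toSubgroup := c.1 K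
  have hinj : Function.Injective f := by
    intro a b hab
    refine Subtype.ext (funext fun L => ?_)
    have hle : K ≤ L := by
      have := hmin (K ⊓ L) inf_le_left
      exact this ▸ inf_le_right
    have ha := a.2 (CategoryTheory.homOfLE hle)
    have hb := b.2 (CategoryTheory.homOfLE hle)
    rw [← ha, ← hb]
    exact congrArg _ hab
  exact not_finite_iff_infinite.2 hG (Finite.of_injective _ hinj)

/-- Each fiber is in bijection with the kernel, whose order times `[G : K]` is `[G : H]`. -/
lemma ncard_preimage_quotientMap {G : Type u} [Group G] {H K : Subgroup G} [H.Normal] [K.Normal]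
    [H.FiniteIndex] (hHK : H ≤ K) (y : G ⧸ K) :
    (QuotientGroup.map H K (MonoidHom.id G) hHK ⁻¹' {y}).ncard = H.relIndex K := by
  set f := QuotientGroup.map H K (MonoidHom.id G) hHK
  have hf : Function.Surjective f := by
    intro z
    obtain ⟨a, rfl⟩ := QuotientGroup.mk_surjective z
    exact ⟨a, rfl⟩
  have h : Nat.card f.ker * K.index = H.index := by
    rw [Subgroup.index_eq_card K, Subgroup.index_eq_card H, ← f.ker.card_mul_index,
      Subgroup.index_ker, f.range_eq_top.2 hf, Subgroup.card_top]
  have : K.FiniteIndex := Subgroup.finiteIndex_of_le hHK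
  rw [← Nat.card_coe_set_eq, Nat.card_congr (MonoidHom.fiberEquivKerOfSurjective hf y)]
  refine Nat.eq_of_mul_eq_mul_right (Nat.pos_of_ne_zero K.index_ne_zero_of_finite) ?_
  rw [h, Subgroup.relIndex_mul_index hHK]

lemma IsRegularCovering.comp_homeomorph {X X' Y : Type*} [TopologicalSpace X]
    [TopologicalSpace X'] {π : X → Y} (h : IsRegularCovering π) (e : X' ≃ₜ X) :
    IsRegularCovering (π ∘ e) := by
  intro x y hxy
  obtain ⟨Φ, hΦ, hxy⟩ := h (e x) (e y) hxy
  refine ⟨(e.trans Φ).trans e.symm, fun z => ?_, ?_⟩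
  · simp [hΦ]
  · simp [hxy]

/-- The tower of finite regular coverings indexed by the normal subgroups of finite index in the
fundamental group. -/
lemma exists_covering_tower {n : ℕ} (M : CompactConformalManifold.{u} n)
    (x₀ : M.toSmoothManifold) :
    ∃ (N : FiniteIndexNormalSubgroup (FundamentalGroup M.toSmoothManifold x₀) →
        CompactConformalManifold.{u} n)
      (π : ∀ H, (N H).toSmoothManifold → M.toSmoothManifold),
      (∀ H, IsFiniteCovering (N H) M (π H)) ∧ (∀ H, IsRegularCovering (π H)) ∧
      ∀ H K, H ≤ K → ∃ q : (N H).toSmoothManifold → (N K).toSmoothManifold, Continuous q ∧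
        (∀ x, π K (q x) = π H x) ∧
        ∀ y, (q ⁻¹' {y}).Finite ∧ (q ⁻¹' {y}).ncard = H.toSubgroup.relIndex K.toSubgroup := by
  have := M.compact
  have := M.connected
  have : LocallyPathConnectedSpace M.toSmoothManifold :=
    ChartedSpace.locallyPathConnectedSpace (E n) _
  have : PathConnectedSpace M.toSmoothManifold := pathConnectedSpace_iff_connectedSpace.2 ‹_›
  obtain ⟨S⟩ := nonempty_simpleNeighborhoods (n := n) M.toSmoothManifold
  let G := FundamentalGroup M.toSmoothManifold x₀
  let τ (H : FiniteIndexNormalSubgroup G) : TopologicalSpace (G ⧸ H.toSubgroup) := ⊥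
  have (H : FiniteIndexNormalSubgroup G) : DiscreteTopology (G ⧸ H.toSubgroup) := ⟨rfl⟩
  let ρ (H : FiniteIndexNormalSubgroup G) := QuotientGroup.mk' H.toSubgroup
  have hcov (H : FiniteIndexNormalSubgroup G) : ∃ (N : CompactConformalManifold.{u} n)
      (e : N.toSmoothManifold ≃ₜ S.Cover (ρ H)), IsFiniteCovering N M (S.proj (ρ H) ∘ e) := by
    have := S.compactSpace_cover (ρ H)
    have := S.pathConnectedSpace_cover (ρ := ρ H) (QuotientGroup.mk'_surjective _)
    refine exists_isFiniteCovering M (S.isCoveringMap_proj (ρ H)) fun x => ?_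
    rw [S.preimage_proj_singleton]
    exact finite_range _
  choose N e hN using hcov
  refine ⟨N, fun H => S.proj (ρ H) ∘ e H, hN,
    fun H => (S.isRegularCovering_proj (ρ H)).comp_homeomorph (e H), fun H K hHK => ?_⟩
  let f := QuotientGroup.map H.toSubgroup K.toSubgroup (MonoidHom.id G) hHK
  let F : S.Cover (ρ H) → S.Cover (ρ K) := S.fiberMap f
  have hF : Continuous F := S.continuous_fiberMap fun l q => map_mul f _ q
  have hfib (y : S.Cover (ρ K)) : (F ⁻¹' {y}).Finite ∧
      (F ⁻¹' {y}).ncard = H.toSubgroup.relIndex K.toSubgroup := by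
    rw [S.preimage_fiberMap_singleton]
    refine ⟨(toFinite _).image _, ?_⟩
    exact (ncard_image_of_injective _ fun a b hab => Bundle.TotalSpace.mk_inj.1 hab).trans
      (ncard_preimage_quotientMap hHK _)
  refine ⟨fun x => (e K).symm (F (e H x)), by fun_prop, fun x => ?_, fun y => ?_⟩
  · change S.proj (ρ K) (e K ((e K).symm _)) = _
    rw [(e K).apply_symm_apply]
    rfl
  · have : (fun x => (e K).symm (F (e H x))) ⁻¹' {y} = (e H).symm '' (F ⁻¹' {e K y}) := by
      ext x
      rw [(e H).symm.image_eq_preimage_symm]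
      simp [Homeomorph.symm_apply_eq]
    rw [this, ncard_image_of_injective _ (e H).symm.injective]
    exact ⟨(hfib _).1.image _, (hfib _).2⟩

namespace ConstrainedOp

variable {n ℓ k : ℕ} (D : ConstrainedOp.{u} n ℓ k)

/-- Lifting a solution through a map of coverings: the energy is multiplied by the degree. -/
lemma exists_pullback_solution (hk : 2 * k < n) {M N L : CompactConformalManifold.{u} n}
    {π : N.toSmoothManifold → M.toSmoothManifold} {p : L.toSmoothManifold → M.toSmoothManifold}
    {q : L.toSmoothManifold → N.toSmoothManifold} (hπ : IsFiniteCovering N M π)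
    (hp : IsFiniteCovering L M p) (hq : Continuous q) (hpq : ∀ x, π (q x) = p x) {d : ℕ}
    (hd : ∀ y, (q ⁻¹' {y}).Finite ∧ (q ⁻¹' {y}).ncard = d) (hd0 : 0 < d)
    {g : Metric M.toSmoothManifold} {h : Metric N.toSmoothManifold}
    {h' : Metric L.toSmoothManifold} (hh : IsPullback π g h) (hh' : IsPullback p g h')
    {v : SmoothFun N.toSmoothManifold} (hv : v ∈ D.cone h) (hv0 : v ≠ 0) (hvs : D.SolvesPDE h v) :
    ∃ w ∈ D.cone h', w ≠ 0 ∧ D.SolvesPDE h' w ∧ D.critEnergy h' w = d * D.critEnergy h v := by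
  have hql := IsLocalDiffeomorph.lift hπ.isLocalDiffeomorph hp.isLocalDiffeomorph hq hpq
  have hqb : IsPullback q h h' := IsPullback.of_comp
    (hπ.isLocalDiffeomorph.contMDiff.mdifferentiable (by simp))
    (hql.contMDiff.mdifferentiable (by simp)) hpq hh hh'
  refine ⟨v.pullback q hql.contMDiff, D.pullback_mem_cone hql hqb hv, fun h0 => hv0 ?_,
    SolvesPDE.pullback D hql hqb hvs,
    D.critEnergy_pullback hk hql hqb (fun y => (hd y).1) (fun y => (hd y).2) v⟩
  refine ContMDiffMap.ext fun y => ?_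
  -- Positive degree makes `q` surjective, so a function with zero pullback is zero.
  obtain ⟨x, rfl⟩ : (q ⁻¹' {y}).Nonempty :=
    nonempty_of_ncard_ne_zero ((hd y).2.trans_ne hd0.ne')
  exact DFunLike.congr_fun h0 x

lemma not_geomEquivalent_of_injective (hk : 2 * k < n) {M : SmoothManifold.{u} n} {g : Metric M}
    {ι : Type*} {v : ι → SmoothFun M}
    (hv : Function.Injective fun i => D.critEnergy g (v i)) (i j : ι) (hij : i ≠ j) :
    ¬ D.GeomEquivalent g (v i) (v j) := fun h =>
  hij (hv (GeomEquivalent.critEnergy_eq D hk h))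

/-- In homogeneity zero, the equation is invariant under multiplication with positive
constants. -/
lemma exists_solutions_of_homogeneity_zero (hk : 2 * k < n) (hk0 : k = 0)
    (M : CompactConformalManifold.{u} n) {g : Metric M.toSmoothManifold}
    {v : SmoothFun M.toSmoothManifold} (hv : v ∈ D.cone g) (hv0 : v ≠ 0) (hvs : D.SolvesPDE g v)
    (m : ℕ) : ∃ w : Fin m → SmoothFun M.toSmoothManifold,
      (∀ i, w i ∈ D.cone g ∧ w i ≠ 0 ∧ D.SolvesPDE g (w i)) ∧
        ∀ i j, i ≠ j → ¬ D.GeomEquivalent g (w i) (w j) := by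
  have := M.compact
  have ht (i : Fin m) : (0 : ℝ) < (i : ℕ) + 1 := by positivity
  refine ⟨fun i => ((i : ℕ) + 1 : ℝ) • v, fun i => ⟨D.smul_mem_cone hv (ht i),
    smul_ne_zero (ht i).ne' hv0, SolvesPDE.smul (by lia) hk0 hvs (ht i)⟩,
    D.not_geomEquivalent_of_injective hk fun i j hij => ?_⟩
  simp only [D.critEnergy_smul _ _ (ht _)] at hij
  have h1 := mul_right_cancel₀ (D.critEnergy_pos hk g hv0).ne' hij
  have h2 := (Real.rpow_left_inj (ht i).le (ht j).le (D.critExp_pos hk).ne').1 h1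
  exact Fin.ext (by exact_mod_cast add_right_cancel h2)

end ConstrainedOp

/-- A finite-index chain along which bounded energies, divided by the index, strictly decrease. -/
lemma exists_chain_index {G : Type u} [Group G]
    (hG : ∀ (H : FiniteIndexNormalSubgroup G) (B : ℕ), ∃ K ≤ H, B < K.toSubgroup.index)
    (δ : FiniteIndexNormalSubgroup G → ℝ) (hδ : ∀ H, 0 < δ H) (B : ℝ) :
    ∃ H : ℕ → FiniteIndexNormalSubgroup G, Antitone H ∧
      ∀ i, B / (H (i + 1)).toSubgroup.index < δ (H i) / (H i).toSubgroup.index := by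
  have hpos (H : FiniteIndexNormalSubgroup G) : (0 : ℝ) < H.toSubgroup.index :=
    Nat.cast_pos.2 (Nat.pos_of_ne_zero H.toSubgroup.index_ne_zero_of_finite)
  have hstep (H : FiniteIndexNormalSubgroup G) : ∃ K ≤ H,
      B / K.toSubgroup.index < δ H / H.toSubgroup.index := by
    -- The required inequality says that the index of `K` exceeds `B [G : H] / δ H`.
    obtain ⟨b, hb⟩ := exists_nat_gt (B * H.toSubgroup.index / δ H)
    obtain ⟨K, hKH, hK⟩ := hG H b
    refine ⟨K, hKH, ?_⟩
    rw [div_lt_div_iff₀ (hpos K) (hpos H), ← div_lt_iff₀' (hδ H)]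
    exact hb.trans (by exact_mod_cast hK)
  choose f hf hfB using hstep
  let H₀ : FiniteIndexNormalSubgroup G := .ofSubgroup ⊤
  refine ⟨fun i => f^[i] H₀, antitone_nat_of_succ_le fun i => ?_, fun i => ?_⟩
  · rw [Function.iterate_succ_apply']; exact hf _
  · simp only [Function.iterate_succ_apply']; exact hfB _

end ConformalYamabe
end

/-! ### The main theorem -/

open ConformalYamabe

theorem mainTheorem1 (n ℓ k : ℕ) (hk : 2 * k < n) (D : ConstrainedOp.{u} n ℓ k)
    (𝒜 : Set (CompactConformalManifold.{u} n))
    (h_pos : ∀ M ∈ 𝒜, 0 < D.yamabeConstant M)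
    (h_sol : ∃ Λ : ℝ, 0 < Λ ∧ ∀ M ∈ 𝒜, ∀ g ∈ M.metrics,
      ∃ v ∈ D.cone g, v ≠ 0 ∧ D.SolvesPDE g v ∧ D.critNorm g v ≤ Λ)
    (h_cov : ∀ M ∈ 𝒜, ∀ (N : CompactConformalManifold.{u} n)
      (π : N.toSmoothManifold → M.toSmoothManifold), IsFiniteCovering N M π → N ∈ 𝒜)
    (M : CompactConformalManifold.{u} n) (hM : M ∈ 𝒜) (x₀ : M.toSmoothManifold)
    (h_inf : HasInfiniteProfiniteFundamentalGroup M.toSmoothManifold x₀) (m : ℕ) :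
    ∃ (N : CompactConformalManifold.{u} n) (π : N.toSmoothManifold → M.toSmoothManifold),
      IsFiniteCovering N M π ∧ IsRegularCovering π ∧
      ∀ g ∈ M.metrics, ∀ h : Metric N.toSmoothManifold, IsPullback π g h →
        ∃ v : Fin m → SmoothFun N.toSmoothManifold,
          (∀ i, v i ∈ D.cone h ∧ v i ≠ 0 ∧ D.SolvesPDE h (v i)) ∧
          ∀ i j, i ≠ j → ¬ D.GeomEquivalent h (v i) (v j) := by
  obtain ⟨Λ, hΛ, h_sol⟩ := h_sol
  obtain ⟨N, π, hN, hreg, htower⟩ := exists_covering_tower M x₀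
  have hN𝒜 H : N H ∈ 𝒜 := h_cov M hM (N H) (π H) (hN H)
  -- A solution for the pullback of a metric on the base.
  have hsolN H (g) (hg : g ∈ M.metrics) : ∃ h ∈ (N H).metrics, IsPullback (π H) g h ∧
      ∃ v ∈ D.cone h, v ≠ 0 ∧ D.SolvesPDE h v ∧ D.critEnergy h v ≤ Λ ^ D.critExp := by
    obtain ⟨h, hh, hpb⟩ := (hN H).pullback_metrics g hg
    obtain ⟨v, hv, hv0, hvs, hvΛ⟩ := h_sol _ (hN𝒜 H) h hh
    exact ⟨h, hh, hpb, v, hv, hv0, hvs, D.critEnergy_le_of_critNorm_le hk hvΛ⟩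
  obtain hk0 | hk0 := k.eq_zero_or_pos
  · let H₀ : FiniteIndexNormalSubgroup (FundamentalGroup M.toSmoothManifold x₀) := .ofSubgroup ⊤
    refine ⟨N H₀, π H₀, hN H₀, hreg H₀, fun g hg h hh => ?_⟩
    obtain ⟨h', -, hh', v, hv, hv0, hvs, -⟩ := hsolN H₀ g hg
    -- The metric `h'` from the conformal class is the given `h`, since a pullback metric is
    -- determined by its defining formula.
    obtain rfl := IsPullback.unique hh' hh
    exact D.exists_solutions_of_homogeneity_zero hk hk0 (N H₀) hv hv0 hvs m
  -- The bound `δ H` holds for all metrics in the conformal class of `N H`, so the chain and the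
  -- covering do not depend on `g`.
  choose δ hδ hδE using fun H => D.exists_le_critEnergy hk hk0 (N H) (h_pos _ (hN𝒜 H))
  obtain ⟨H, hH, hHδ⟩ := exists_chain_index (exists_le_index_lt h_inf) δ hδ (Λ ^ D.critExp)
  refine ⟨N (H m), π (H m), hN _, hreg _, fun g hg h hh => ?_⟩
  choose h' hh'm hh' v hv hv0 hvs hvE using fun i => hsolN (H i) g hg
  have hidx (i : ℕ) : (0 : ℝ) < (H i).toSubgroup.index :=
    Nat.cast_pos.2 (Nat.pos_of_ne_zero (H i).toSubgroup.index_ne_zero_of_finite)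
  -- The uniform upper bound at level `i + 1`, divided by the degree, lies below the lower bound at
  -- level `i`, divided by its degree.
  have hanti : StrictAnti fun i => D.critEnergy (h' i) (v i) / (H i).toSubgroup.index := by
    refine strictAnti_nat_of_succ_lt fun i => ?_
    calc _ ≤ Λ ^ D.critExp / (H (i + 1)).toSubgroup.index := by
          gcongr; exact hvE _
      _ < δ (H i) / (H i).toSubgroup.index := hHδ i
      _ ≤ _ := by gcongr; exact hδE _ _ (hh'm i) _ (hv i) (hv0 i) (hvs i)
  -- The covering of level `m` has degree `[H i : H m] = [G : H m] / [G : H i]` over level `i`; the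
  -- factor `[G : H m]` is common to all lifts.
  have hlift (i : Fin m) : ∃ w ∈ D.cone h, w ≠ 0 ∧ D.SolvesPDE h w ∧ D.critEnergy h w =
      (H m).toSubgroup.index * (D.critEnergy (h' i) (v i) / (H i).toSubgroup.index) := by
    have hle : H m ≤ H i := hH i.is_lt.le
    have hrel := Subgroup.relIndex_mul_index (H := (H m).toSubgroup) (K := (H i).toSubgroup) hle
    have hrel0 : 0 < (H m).toSubgroup.relIndex (H i).toSubgroup :=
      Nat.pos_of_ne_zero fun h0 => (hidx m).ne' (by rw [← hrel, h0, zero_mul, Nat.cast_zero])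
    obtain ⟨q, hq, hπq, hfib⟩ := htower (H m) (H i) hle
    obtain ⟨w, hw, hw0, hws, hwE⟩ := D.exists_pullback_solution hk (hN (H i)) (hN (H m)) hq hπq
      hfib hrel0 (hh' i) hh (hv i) (hv0 i) (hvs i)
    refine ⟨w, hw, hw0, hws, ?_⟩
    rw [hwE, ← hrel, Nat.cast_mul]
    field_simp [(hidx i).ne']
  choose w hw hw0 hws hwE using hlift
  refine ⟨w, fun i => ⟨hw i, hw0 i, hws i⟩,
    D.not_geomEquivalent_of_injective hk fun i j hij => Fin.ext (hanti.injective ?_)⟩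
  simp only [hwE] at hij
  exact mul_left_cancel₀ (hidx m).ne' hij
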